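/- Let $n\ge 3$. Let $B_n=\langle\sigma_1,\dots,\sigma_{n-1}\mid \sigma_i\sigma_{i+1}\sigma_i=\sigma_{i+1}\sigma_i\sigma_{i+1},\ \sigma_i\sigma_j=\sigma_j\sigma_i\ (|i-j|\ge 2)\rangle$ be the Artin braid group, let $\sigma\colon B_n\to S_n$, $\sigma_i\mapsto(i,i+1)$, be the natural homomorphism (permutations are multiplied from left to right), let $P_n=\ker\sigma$, and let $\overline\sigma\colon B_n/[P_n,P_n]\to S_n$ be the induced homomorphism. For $1\le i<j\le n$ let $A_{i,j}=A_{j,i}\in B_n/[P_n,P_n]$ be the class of $\sigma_{j-1}\cdots\sigma_{i+1}\sigma_i^2\sigma_{i+1}^{-1}\cdots\sigma_{j-1}^{-1}\in P_n$; integer exponents $m_{i,j}$ are indexed by unordered pairs, $m_{i,j}=m_{j,i}$. Let $p\le n$ be an odd prime, let $k\in\{1,\dots,p-1\}$, and let $\mathbb{Z}_p\rtimes_{\alpha_k}\mathbb{Z}$ be the semidirect product in which the generator of $\mathbb{Z}$ acts on $\mathbb{Z}_p$ (written multiplicatively) by $\alpha_k(\lambda)=\lambda^k$; let $A$ and $B$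 be the standard generators of $\mathbb{Z}_p$ and $\mathbb{Z}$ in it. Put $$\delta_{0,p}=\sigma_{p-1}\cdots\sigma_{\frac{p+1}{2}}\,\sigma_{\frac{p-1}{2}}^{-1}\cdots\sigma_1^{-1}\in B_n/[P_n,P_n].$$ Then the group $\mathbb{Z}_p\rtimes_{\alpha_k}\mathbb{Z}=\langle A,B\mid A^p=1,\ BAB^{-1}=A^k\rangle$ embeds in $B_n/[P_n,P_n]$. More precisely: 1. $\mathbb{Z}_p\rtimes_{\alpha_k}\mathbb{Z}$ has the presentation $\langle A,B\mid A^p=1,\ BAB^{-1}=A^k\rangle$ on the generators $A,B$, and $\delta_{0,p}$ has order $p$. 2. There is $\gamma\in B_n/[P_n,P_n]$ such that $\overline\sigma(\gamma)\,(1,\dots,p)\,\overline\sigma(\gamma)^{-1}=(1,\dots,p)^k$. 3. For every such $\gamma$ there are integers $c_{i,j}$ with $\gamma\delta_{0,p}\gamma^{-1}=\bigl(\prod_{i<j}A_{i,j}^{c_{i,j}}\bigr)\delta_{0,p}^k$ such that, with $\theta=(1,\dots,p)^k$: for all integers $x_{i,j}$, the element $\beta=\bigl(\prod_{i<j}A_{i,j}^{x_{i,j}}\bigr)\gamma$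 satisfies $\beta\delta_{0,p}\beta^{-1}=\delta_{0,p}^k$ if and only if $$x_{i,j}+c_{i,j}-x_{\theta(i),\theta(j)}=0\qquad\text{for all }1\le i<j\le n;$$ and this system has an integer solution $(x_{i,j})$ for which there is an injective homomorphism $\mathbb{Z}_p\rtimes_{\alpha_k}\mathbb{Z}\to B_n/[P_n,P_n]$ with $A\mapsto\delta_{0,p}$ and $B\mapsto\bigl(\prod_{i<j}A_{i,j}^{x_{i,j}}\bigr)\gamma$. -/

import Mathlib

/-- The free group letter `σ_{i+1}` (generators are indexed from `0`). -/
abbrev braidLetter (n : ℕ) (i : Fin (n - 1)) : FreeGroup (Fin (n - 1)) := FreeGroup.of i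

/-- Artin's relators on `n - 1` letters: `σ_i σ_{i+1} σ_i = σ_{i+1} σ_i σ_{i+1}`, and
`σ_i σ_j = σ_j σ_i` for `|i - j| ≥ 2`. -/
def braidRels (n : ℕ) : Set (FreeGroup (Fin (n - 1))) :=
  {r | ∃ i j : Fin (n - 1), (i : ℕ) + 1 = j ∧
      r = braidLetter n i * braidLetter n j * braidLetter n i *
        (braidLetter n j * braidLetter n i * braidLetter n j)⁻¹} ∪
  {r | ∃ i j : Fin (n - 1), ((i : ℕ) + 2 ≤ j ∨ (j : ℕ) + 2 ≤ i) ∧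
      r = braidLetter n i * braidLetter n j * (braidLetter n j * braidLetter n i)⁻¹}

/-- The Artin braid group `B_n` on `n` strings. -/
abbrev ArtinBraidGroup (n : ℕ) : Type := PresentedGroup (braidRels n)

/-- The transposition `(i, i+1)` of the strings `Fin n = {0, …, n-1}`. -/
def adjSwap (n : ℕ) (i : Fin (n - 1)) : Equiv.Perm (Fin n) :=
  Equiv.swap ⟨i, by omega⟩ ⟨i + 1, by omega⟩

theorem adjSwap_braid (n : ℕ) (i j : Fin (n - 1)) (h : (i : ℕ) + 1 = j) :
    adjSwap n i * adjSwap n j * adjSwap n i = adjSwap n j * adjSwap n i * adjSwap n j := by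
  obtain ⟨i, hi⟩ := i
  obtain ⟨j, hj⟩ := j
  simp only at h
  subst h
  ext ⟨x, hx⟩
  simp only [adjSwap, Equiv.Perm.coe_mul, Function.comp_apply, Equiv.swap_apply_def, Fin.ext_iff]
  grind

theorem adjSwap_comm (n : ℕ) (i j : Fin (n - 1)) (h : (i : ℕ) + 2 ≤ j ∨ (j : ℕ) + 2 ≤ i) :
    adjSwap n i * adjSwap n j = adjSwap n j * adjSwap n i := by
  obtain ⟨i, hi⟩ := i
  obtain ⟨j, hj⟩ := j
  simp only at h
  ext ⟨x, hx⟩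
  simp only [adjSwap, Equiv.Perm.coe_mul, Function.comp_apply, Equiv.swap_apply_def, Fin.ext_iff]
  grind

theorem adjSwap_rels (n : ℕ) : ∀ r ∈ braidRels n,
    FreeGroup.lift (fun i => MulOpposite.op (adjSwap n i)) r = 1 := by
  rintro r (⟨i, j, h, rfl⟩ | ⟨i, j, h, rfl⟩)
  · simp only [map_mul, map_inv, FreeGroup.lift_apply_of, mul_inv_eq_one, ← MulOpposite.op_mul]
    congr 1
    simpa only [mul_assoc] using adjSwap_braid n i j h
  · simp only [map_mul, map_inv, FreeGroup.lift_apply_of, mul_inv_eq_one, ← MulOpposite.op_mul]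
    congr 1
    exact (adjSwap_comm n i j h).symm

/-- The homomorphism `σ : B_n → S_n`, `σ_i ↦ (i, i+1)`. Permutations are read from left to right,
`(α · β) (i) = β (α (i))`, so `S_n` is the opposite of Mathlib's `Equiv.Perm (Fin n)`. -/
def braidPerm (n : ℕ) : ArtinBraidGroup n →* (Equiv.Perm (Fin n))ᵐᵒᵖ :=
  PresentedGroup.toGroup (adjSwap_rels n)

/-- The pure braid group `P_n`. -/
def pureBraidGroup (n : ℕ) : Subgroup (ArtinBraidGroup n) := (braidPerm n).ker

instance pureBraidGroup_normal (n : ℕ) : (pureBraidGroup n).Normal :=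
  inferInstanceAs ((braidPerm n).ker).Normal

/-- The crystallographic quotient `B_n / [P_n, P_n]`. -/
abbrev BraidQuotient (n : ℕ) : Type :=
  ArtinBraidGroup n ⧸ ⁅pureBraidGroup n, pureBraidGroup n⁆

theorem commutator_pure_le_ker (n : ℕ) :
    ⁅pureBraidGroup n, pureBraidGroup n⁆ ≤ (braidPerm n).ker :=
  Subgroup.commutator_le_left (pureBraidGroup n) (pureBraidGroup n)

/-- The homomorphism `B_n / [P_n, P_n] → S_n` induced by `σ`. -/
def braidQuotientPerm (n : ℕ) : BraidQuotient n →* (Equiv.Perm (Fin n))ᵐᵒᵖ :=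
  QuotientGroup.lift ⁅pureBraidGroup n, pureBraidGroup n⁆ (braidPerm n)
    (fun _ hx => commutator_pure_le_ker n hx)

/-- The class of `σ_{i+1}` in `B_n / [P_n, P_n]`, for `i < n - 1` (and `1` out of range). -/
def quotGen (n i : ℕ) : BraidQuotient n :=
  if h : i < n - 1 then
    ((PresentedGroup.of ⟨i, h⟩ : ArtinBraidGroup n) : BraidQuotient n)
  else 1

/-- For odd `p = 2 m + 1`, the element `δ_{0,p} = σ_{2m} ⋯ σ_{m+1} σ_m⁻¹ ⋯ σ_1⁻¹`. -/
def deltaElt (n p : ℕ) : BraidQuotient n :=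
  ((List.range (p / 2)).reverse.map (fun i => quotGen n (p / 2 + i))).prod *
    ((List.range (p / 2)).reverse.map (fun i => (quotGen n i)⁻¹)).prod

/-- The word `σ_{j-1} ⋯ σ_{i+1}` for strings numbered `i < j` (here counted from `0`, so the
letters are `quotGen n (j-1), …, quotGen n (i+1)`). -/
def bandConj (n i j : ℕ) : BraidQuotient n :=
  ((List.range' (i + 1) (j - 1 - i)).reverse.map (quotGen n)).prod

/-- For `i < j`, the pure braid
`A_{i,j} = σ_{j-1} ⋯ σ_{i+1} σ_i² σ_{i+1}⁻¹ ⋯ σ_{j-1}⁻¹` modulo `[P_n, P_n]`. -/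
def pureGen (n i j : ℕ) : BraidQuotient n :=
  bandConj n i j * quotGen n i ^ 2 * (bandConj n i j)⁻¹

/-- The product of the `A_{i,j} ^ x_{i,j}` over all `i < j`, taken in lexicographic order (the
factors commute). Exponents are symmetric, `x_{i,j} = x_{j,i}`; diagonal values are not used. -/
def pureProd (n : ℕ) (x : Sym2 (Fin n) → ℤ) : BraidQuotient n :=
  ((List.finRange n).flatMap (fun i =>
    ((List.finRange n).filter (fun j : Fin n => i < j)).map
      (fun j : Fin n => pureGen n i j ^ x s(i, j)))).prod

/-- The cycle `(1, …, p)`, sending each of the first `p` points to the next one. -/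
def firstCycle (n p : ℕ) : Equiv.Perm (Fin n) := ((List.finRange n).take p).formPerm

/-- The automorphism `α_k : λ ↦ λ ^ k` of the (multiplicatively written) cyclic group `ℤ_p`. -/
def alphaAut (p k : ℕ) (h : k.Coprime p) : MulAut (Multiplicative (ZMod p)) :=
  MulEquiv.mk'
    { toFun := fun a => a ^ k
      invFun := fun a =>
        Multiplicative.ofAdd (((ZMod.unitOfCoprime k h)⁻¹ : (ZMod p)ˣ) * a.toAdd)
      left_inv := fun a => by
        apply Multiplicative.toAdd.injective
        have : (k : ZMod p) = (ZMod.unitOfCoprime k h : (ZMod p)ˣ) := rfl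
        simp only [toAdd_ofAdd, toAdd_pow, nsmul_eq_mul]
        rw [this, Units.inv_mul_cancel_left]
      right_inv := fun a => by
        apply Multiplicative.toAdd.injective
        have : (k : ZMod p) = (ZMod.unitOfCoprime k h : (ZMod p)ˣ) := rfl
        simp only [toAdd_ofAdd, toAdd_pow, nsmul_eq_mul]
        rw [this, Units.mul_inv_cancel_left] }
    (fun a b => mul_pow a b k)

/-- The semidirect product `ℤ_p ⋊_{α_k} ℤ`, the generator of `ℤ` acting by `α_k`. -/
abbrev ZpSemidirectZ (p k : ℕ) (h : k.Coprime p) : Type :=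
  SemidirectProduct (Multiplicative (ZMod p)) (Multiplicative ℤ)
    (zpowersHom (MulAut (Multiplicative (ZMod p))) (alphaAut p k h))

/-- The generator `A` of the factor `ℤ_p`. -/
def genA (p k : ℕ) (h : k.Coprime p) : ZpSemidirectZ p k h :=
  SemidirectProduct.inl (Multiplicative.ofAdd 1)

/-- The generator `B` of the factor `ℤ`. -/
def genB (p k : ℕ) (h : k.Coprime p) : ZpSemidirectZ p k h :=
  SemidirectProduct.inr (Multiplicative.ofAdd 1)

/-- The relators `A ^ p` and `B A B⁻¹ A ^ (-k)` in the free group on `A` (letter `0`) and `B`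
(letter `1`). -/
def semidirectRels (p k : ℕ) : Set (FreeGroup (Fin 2)) :=
  {FreeGroup.of 0 ^ p,
    FreeGroup.of 1 * FreeGroup.of 0 * (FreeGroup.of 1)⁻¹ * (FreeGroup.of 0 ^ k)⁻¹}

theorem coprime_of_pos_of_lt_prime {p k : ℕ} (hp : p.Prime) (hk : 1 ≤ k) (hkp : k ≤ p - 1) :
    k.Coprime p :=
  (Nat.coprime_of_lt_prime (by omega) (by have := hp.pos; omega) hp).symm

/-! An element of `BraidQuotient n` is determined by its permutation together with the signed
crossing number of each pair of strings (`braidQuotient_ext`), so every identity here reduces to one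
of permutations and one of integers. Both data are recorded by a homomorphism to a semidirect
product of integer functions on pairs with `S_n`; it kills `[P_n, P_n]` because pure braids land in
the abelian factor. For faithfulness, conjugation by `σ_k` permutes the `A_{i,j}`, and modulo them
the `σ_i` satisfy the Coxeter relations of `S_n`. Hence the `A_{i,j}` generate the kernel of the map
to `S_n` (`mem_pureSubgroup_of_strandPerm_eq_one`), and they are independent because `A_{i,j}` has
crossing number 2 on `{i,j}` and 0 on every other pair.

The crossing numbers of `δ_{0,p}` are arranged so that their sums along each orbit of the `p`-cycle
cancel, whence `δ_{0,p} ^ p = 1`. The equation `β δ β⁻¹ = δ ^ k` turns into `x ∘ θ = x + c` on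
pairs. The sums of `c` over the orbits of `θ` vanish, because `γ δ γ⁻¹` and `δ ^ k` both have
trivial `p`-th power; hence `c` is a coboundary (`exists_coboundary`). Solutions may be shifted by
constants, so the total crossing number of `β` can be made nonzero. It is a homomorphism to `ℤ` that
kills `δ`, and so it makes the map from the semidirect product injective. -/

/-! ### Crossing numbers of pairs of strings. -/

/-- Permutations of the strings, read from left to right, act on integer-valued functions on pairs
of strings by precomposition. -/
def pairAction (n : ℕ) :
    (Equiv.Perm (Fin n))ᵐᵒᵖ →* MulAut (Sym2 (Fin n) → Multiplicative ℤ) where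
  toFun g :=
    { toFun := fun v e => v (Sym2.map g.unop e)
      invFun := fun v e => v (Sym2.map g.unop.symm e)
      left_inv := fun v => by
        ext e; simp [Sym2.map_map]
      right_inv := fun v => by
        ext e; simp [Sym2.map_map]
      map_mul' := fun v w => rfl }
  map_one' := by
    ext v e
    simp
  map_mul' g h := by
    ext v e
    simp [Sym2.map_map]

@[simp]
theorem pairAction_apply (n : ℕ) (g : (Equiv.Perm (Fin n))ᵐᵒᵖ)
    (v : Sym2 (Fin n) → Multiplicative ℤ) (e : Sym2 (Fin n)) :
    pairAction n g v e = v (Sym2.map g.unop e) := rfl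

/-- The semidirect product recording crossing numbers of pairs of strings and the permutation. -/
abbrev CrossingGroup (n : ℕ) : Type :=
  SemidirectProduct (Sym2 (Fin n) → Multiplicative ℤ) (Equiv.Perm (Fin n))ᵐᵒᵖ (pairAction n)

/-- The indicator function of a pair, with multiplicatively written values. -/
def pairIndicator (n : ℕ) (p : Sym2 (Fin n)) : Sym2 (Fin n) → Multiplicative ℤ :=
  fun e => Multiplicative.ofAdd (if e = p then 1 else 0)

theorem pairAction_pairIndicator (n : ℕ) (g : Equiv.Perm (Fin n)) (a b : Fin n) :
    pairAction n (MulOpposite.op g) (pairIndicator n s(a, b)) =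
      pairIndicator n s(g⁻¹ a, g⁻¹ b) := by
  ext e
  have : Sym2.map g e = s(a, b) ↔ e = s(g⁻¹ a, g⁻¹ b) := by
    induction e with
    | _ x y => simp [Equiv.eq_symm_apply]
  simp [pairIndicator, this]

/-- The image of `σ_{i+1}` in the crossing group. -/
def crossingGen (n : ℕ) (i : Fin (n - 1)) : CrossingGroup n :=
  ⟨pairIndicator n s(⟨i, by omega⟩, ⟨i + 1, by omega⟩), MulOpposite.op (adjSwap n i)⟩

theorem adjSwap_inv (n : ℕ) (i : Fin (n - 1)) : (adjSwap n i)⁻¹ = adjSwap n i :=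
  Equiv.swap_inv _ _

/-- On either side each of the three pairs among `i, i+1, i+2` is crossed exactly once, only in a
different order. -/
theorem crossingGen_braid (n : ℕ) (i j : Fin (n - 1)) (h : (i : ℕ) + 1 = j) :
    crossingGen n i * crossingGen n j * crossingGen n i =
      crossingGen n j * crossingGen n i * crossingGen n j := by
  refine SemidirectProduct.ext ?_ ?_
  · obtain ⟨i, hi⟩ := i
    obtain ⟨j, hj⟩ := j
    simp only at h
    subst h
    simp only [crossingGen, SemidirectProduct.mul_left, SemidirectProduct.mul_right,
      pairAction_pairIndicator, ← MulOpposite.op_mul, mul_inv_rev, adjSwap_inv]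
    have h1 : adjSwap n ⟨i, hi⟩ ⟨i, by omega⟩ = ⟨i + 1, by omega⟩ := Equiv.swap_apply_left _ _
    have h2 : adjSwap n ⟨i, hi⟩ ⟨i + 1, by omega⟩ = ⟨i, by omega⟩ := Equiv.swap_apply_right _ _
    have h3 : adjSwap n ⟨i, hi⟩ ⟨i + 1 + 1, by omega⟩ = ⟨i + 1 + 1, by omega⟩ :=
      Equiv.swap_apply_of_ne_of_ne (by simp [Fin.ext_iff]; omega) (by simp [Fin.ext_iff])
    have h4 : adjSwap n ⟨i + 1, hj⟩ ⟨i + 1, by omega⟩ = ⟨i + 1 + 1, by omega⟩ :=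
      Equiv.swap_apply_left _ _
    have h5 : adjSwap n ⟨i + 1, hj⟩ ⟨i + 1 + 1, by omega⟩ = ⟨i + 1, by omega⟩ :=
      Equiv.swap_apply_right _ _
    have h6 : adjSwap n ⟨i + 1, hj⟩ ⟨i, by omega⟩ = ⟨i, by omega⟩ :=
      Equiv.swap_apply_of_ne_of_ne (by simp [Fin.ext_iff]) (by simp [Fin.ext_iff]; omega)
    simp only [Equiv.Perm.mul_apply, h1, h2, h3, h4, h5, h6]
    rw [mul_assoc, mul_comm, mul_comm (pairIndicator n s(⟨i, _⟩, ⟨i + 1 + 1, _⟩))]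
  · simp only [crossingGen, SemidirectProduct.mul_right, ← MulOpposite.op_mul]
    congr 1
    simpa only [mul_assoc] using adjSwap_braid n i j h

theorem crossingGen_comm (n : ℕ) (i j : Fin (n - 1)) (h : (i : ℕ) + 2 ≤ j ∨ (j : ℕ) + 2 ≤ i) :
    crossingGen n i * crossingGen n j = crossingGen n j * crossingGen n i := by
  refine SemidirectProduct.ext ?_ ?_
  · have key : ∀ i j : Fin (n - 1), ((i : ℕ) + 2 ≤ j ∨ (j : ℕ) + 2 ≤ i) →
        adjSwap n i ⟨j, by omega⟩ = ⟨j, by omega⟩ ∧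
        adjSwap n i ⟨j + 1, by omega⟩ = ⟨j + 1, by omega⟩ := fun i j h =>
      ⟨Equiv.swap_apply_of_ne_of_ne (by simp only [ne_eq, Fin.ext_iff]; omega)
          (by simp only [ne_eq, Fin.ext_iff]; omega),
        Equiv.swap_apply_of_ne_of_ne (by simp only [ne_eq, Fin.ext_iff]; omega)
          (by simp only [ne_eq, Fin.ext_iff]; omega)⟩
    simp only [crossingGen, SemidirectProduct.mul_left,
      pairAction_pairIndicator, adjSwap_inv, key i j h, key j i h.symm]
    exact mul_comm _ _
  · simp only [crossingGen, SemidirectProduct.mul_right, ← MulOpposite.op_mul]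
    congr 1
    exact (adjSwap_comm n i j h).symm

theorem crossingGen_rels (n : ℕ) : ∀ r ∈ braidRels n, FreeGroup.lift (crossingGen n) r = 1 := by
  rintro r (⟨i, j, h, rfl⟩ | ⟨i, j, h, rfl⟩)
  · simp only [map_mul, map_inv, FreeGroup.lift_apply_of, mul_inv_eq_one]
    exact crossingGen_braid n i j h
  · simp only [map_mul, map_inv, FreeGroup.lift_apply_of, mul_inv_eq_one]
    exact crossingGen_comm n i j h

/-- The homomorphism from the braid group to the crossing group. -/
def braidCrossing (n : ℕ) : ArtinBraidGroup n →* CrossingGroup n :=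
  PresentedGroup.toGroup (crossingGen_rels n)

theorem braidCrossing_right (n : ℕ) (g : ArtinBraidGroup n) :
    (braidCrossing n g).right = braidPerm n g := by
  have : SemidirectProduct.rightHom.comp (braidCrossing n) = braidPerm n := by
    refine PresentedGroup.ext fun i => ?_
    simp only [MonoidHom.comp_apply, braidCrossing, braidPerm]
    rfl
  exact DFunLike.congr_fun this g

theorem commutator_pure_le_ker_braidCrossing (n : ℕ) :
    ⁅pureBraidGroup n, pureBraidGroup n⁆ ≤ (braidCrossing n).ker := by
  refine Subgroup.commutator_le.2 fun g hg h hh => ?_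
  have hg' : (braidCrossing n g).right = 1 := (braidCrossing_right n g).trans hg
  have hh' : (braidCrossing n h).right = 1 := (braidCrossing_right n h).trans hh
  rw [MonoidHom.mem_ker, map_commutatorElement, commutatorElement_eq_one_iff_mul_comm]
  refine SemidirectProduct.ext ?_ ?_
  · simp [SemidirectProduct.mul_left, hg', hh', mul_comm]
  · simp [hg', hh']

/-- The homomorphism from `B_n / [P_n, P_n]` to the crossing group. -/
def quotCrossing (n : ℕ) : BraidQuotient n →* CrossingGroup n :=
  QuotientGroup.lift ⁅pureBraidGroup n, pureBraidGroup n⁆ (braidCrossing n)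
    (fun _ hx => commutator_pure_le_ker_braidCrossing n hx)

/-- The permutation of the strings defined by an element of `B_n / [P_n, P_n]`. -/
def strandPerm {n : ℕ} (g : BraidQuotient n) : Equiv.Perm (Fin n) := (braidQuotientPerm n g).unop

/-- The signed number of crossings of two strings, labelled by their starting positions. -/
def crossNum {n : ℕ} (g : BraidQuotient n) (e : Sym2 (Fin n)) : ℤ :=
  ((quotCrossing n g).left e).toAdd

theorem quotCrossing_right (n : ℕ) (g : BraidQuotient n) :
    (quotCrossing n g).right = braidQuotientPerm n g := by
  induction g using QuotientGroup.induction_on with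
  | _ g => exact braidCrossing_right n g

theorem braidQuotientPerm_eq {n : ℕ} (g : BraidQuotient n) :
    braidQuotientPerm n g = MulOpposite.op (strandPerm g) := rfl

@[simp]
theorem strandPerm_one {n : ℕ} : strandPerm (1 : BraidQuotient n) = 1 := by
  simp [strandPerm]

@[simp]
theorem strandPerm_mul {n : ℕ} (g h : BraidQuotient n) :
    strandPerm (g * h) = strandPerm h * strandPerm g := by
  simp [strandPerm]

@[simp]
theorem strandPerm_inv {n : ℕ} (g : BraidQuotient n) :
    strandPerm g⁻¹ = (strandPerm g)⁻¹ := by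
  simp [strandPerm]

@[simp]
theorem strandPerm_pow {n : ℕ} (g : BraidQuotient n) (k : ℕ) :
    strandPerm (g ^ k) = strandPerm g ^ k := by
  simp [strandPerm]

@[simp]
theorem crossNum_one {n : ℕ} (e : Sym2 (Fin n)) : crossNum (1 : BraidQuotient n) e = 0 := by
  simp [crossNum]

@[simp]
theorem crossNum_mul {n : ℕ} (g h : BraidQuotient n) (e : Sym2 (Fin n)) :
    crossNum (g * h) e = crossNum g e + crossNum h (Sym2.map (strandPerm g) e) := by
  simp [crossNum, SemidirectProduct.mul_left, quotCrossing_right, strandPerm]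

@[simp]
theorem crossNum_inv {n : ℕ} (g : BraidQuotient n) (e : Sym2 (Fin n)) :
    crossNum g⁻¹ e = -crossNum g (Sym2.map ((strandPerm g)⁻¹ : Equiv.Perm (Fin n)) e) := by
  have := crossNum_mul g⁻¹ g e
  rw [inv_mul_cancel, crossNum_one, strandPerm_inv] at this
  linarith

theorem crossNum_pow {n : ℕ} (g : BraidQuotient n) (k : ℕ) (e : Sym2 (Fin n)) :
    crossNum (g ^ k) e =
      ∑ t ∈ Finset.range k, crossNum g (Sym2.map (strandPerm g ^ t : Equiv.Perm (Fin n)) e) := by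
  induction k with
  | zero => simp
  | succ k ih => rw [pow_succ, crossNum_mul, ih, Finset.sum_range_succ, strandPerm_pow]

theorem quotGen_of_lt {n i : ℕ} (h : i < n - 1) : quotGen n i =
    ((PresentedGroup.of ⟨i, h⟩ : ArtinBraidGroup n) : BraidQuotient n) := dif_pos h

theorem strandPerm_quotGen {n i : ℕ} (h : i + 1 < n) :
    strandPerm (quotGen n i) = Equiv.swap ⟨i, by omega⟩ ⟨i + 1, h⟩ := by
  rw [quotGen_of_lt (by omega)]
  have : braidPerm n (PresentedGroup.of ⟨i, by omega⟩) =
      MulOpposite.op (adjSwap n ⟨i, by omega⟩) := PresentedGroup.toGroup.of _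
  exact congrArg MulOpposite.unop this

theorem crossNum_quotGen {n i : ℕ} (h : i + 1 < n) (e : Sym2 (Fin n)) :
    crossNum (quotGen n i) e = if e = s(⟨i, by omega⟩, ⟨i + 1, h⟩) then 1 else 0 := by
  rw [quotGen_of_lt (by omega)]
  have : braidCrossing n (PresentedGroup.of ⟨i, by omega⟩) = crossingGen n ⟨i, by omega⟩ :=
    PresentedGroup.toGroup.of _
  exact congrArg (fun g : CrossingGroup n => (g.left e).toAdd) this

theorem quotGen_braid {n i : ℕ} (h : i + 2 < n) :
    quotGen n i * quotGen n (i + 1) * quotGen n i =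
      quotGen n (i + 1) * quotGen n i * quotGen n (i + 1) := by
  rw [quotGen_of_lt (i := i) (by omega), quotGen_of_lt (i := i + 1) (by omega)]
  simp only [← QuotientGroup.mk_mul]
  congr 1
  rw [← mul_inv_eq_one]
  exact PresentedGroup.one_of_mem (rels := braidRels n)
    (Or.inl ⟨⟨i, by omega⟩, ⟨i + 1, by omega⟩, rfl, rfl⟩)

theorem quotGen_comm {n i j : ℕ} (h : i + 2 ≤ j) (hj : j + 1 < n) :
    quotGen n i * quotGen n j = quotGen n j * quotGen n i := by
  rw [quotGen_of_lt (i := i) (by omega), quotGen_of_lt (i := j) (by omega)]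
  simp only [← QuotientGroup.mk_mul]
  congr 1
  rw [← mul_inv_eq_one]
  exact PresentedGroup.one_of_mem (rels := braidRels n)
    (Or.inr ⟨⟨i, by omega⟩, ⟨j, by omega⟩, Or.inl h, rfl⟩)

theorem closure_quotGen (n : ℕ) :
    Subgroup.closure {g : BraidQuotient n | ∃ i, i + 1 < n ∧ g = quotGen n i} = ⊤ := by
  have h := congrArg (Subgroup.map (QuotientGroup.mk' ⁅pureBraidGroup n, pureBraidGroup n⁆))
    (PresentedGroup.closure_range_of (braidRels n))
  rw [MonoidHom.map_closure, ← MonoidHom.range_eq_map,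
    MonoidHom.range_eq_top.2 (QuotientGroup.mk'_surjective _)] at h
  rw [← top_le_iff, ← h]
  refine Subgroup.closure_mono ?_
  rintro _ ⟨_, ⟨⟨i, hi⟩, rfl⟩, rfl⟩
  exact ⟨i, by omega, (quotGen_of_lt hi).symm⟩

/-- Elements of the kernel of `B_n / [P_n, P_n] → S_n` commute. -/
theorem mul_comm_of_strandPerm_eq_one {n : ℕ} {g h : BraidQuotient n}
    (hg : strandPerm g = 1) (hh : strandPerm h = 1) : g * h = h * g := by
  induction g using QuotientGroup.induction_on with
  | _ g =>
  induction h using QuotientGroup.induction_on with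
  | _ h =>
  have hg' : g ∈ pureBraidGroup n := MulOpposite.unop_injective hg
  have hh' : h ∈ pureBraidGroup n := MulOpposite.unop_injective hh
  rw [← commutatorElement_eq_one_iff_mul_comm]
  exact (QuotientGroup.eq_one_iff _).2 (Subgroup.commutator_mem_commutator hg' hh')

/-! ### The Coxeter presentation of the symmetric group. -/

/-- The braid relations for the first `n - 1` terms of a sequence in a group. -/
structure IsBraidSequence {W : Type*} [Group W] (n : ℕ) (s : ℕ → W) : Prop where
  braid : ∀ i, i + 2 < n → s i * s (i + 1) * s i = s (i + 1) * s i * s (i + 1)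
  comm : ∀ i j, i + 2 ≤ j → j + 1 < n → s i * s j = s j * s i

/-- The product `s (m - 1) * ⋯ * s j`. -/
def descProd {W : Type*} [Group W] (s : ℕ → W) (j m : ℕ) : W :=
  ((List.range' j (m - j)).reverse.map s).prod

section Descending

variable {W : Type*} [Group W] {s : ℕ → W}

@[simp]
theorem descProd_self (j : ℕ) : descProd s j j = 1 := by
  simp [descProd]

theorem descProd_succ {j m : ℕ} (h : j ≤ m) : descProd s j (m + 1) = s m * descProd s j m := by
  have : m + 1 - j = (m - j) + 1 := by omega
  rw [descProd, this, List.range'_1_concat, descProd]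
  simp [Nat.add_sub_cancel' h]

theorem descProd_mul {j l m : ℕ} (h : j ≤ l) (h' : l ≤ m) :
    descProd s l m * descProd s j l = descProd s j m := by
  induction m, h' using Nat.le_induction with
  | base => simp
  | succ m hm ih => rw [descProd_succ hm, descProd_succ (h.trans hm), mul_assoc, ih]

theorem descProd_eq_mul {j m : ℕ} (h : j < m) : descProd s j m = descProd s (j + 1) m * s j := by
  rw [← descProd_mul (Nat.le_succ j) h, descProd_succ le_rfl, descProd_self, mul_one]

theorem commute_descProd {x : W} {j m : ℕ} (h : ∀ l, j ≤ l → l < m → x * s l = s l * x) :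
    x * descProd s j m = descProd s j m * x := by
  rcases le_or_gt j m with hjm | hjm
  · induction m, hjm using Nat.le_induction with
    | base => simp
    | succ m hm ih =>
      rw [descProd_succ hm, ← mul_assoc, h m hm (Nat.lt_succ_self m), mul_assoc,
        ih fun l hl hl' => h l hl (by omega), mul_assoc]
  · have : m - j = 0 := by omega
    simp [descProd, this]

/-- `s l` passes the factors above `s (l + 1)`, one braid relation replaces `s l * s (l + 1) * s l`,
and the resulting right-hand `s (l + 1)` passes the factors below `s l`. -/
theorem IsBraidSequence.mul_descProd {n : ℕ} (hs : IsBraidSequence n s) {j l m : ℕ} (hj : j ≤ l)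
    (hl : l + 2 ≤ m) (hm : m < n) : s l * descProd s j m = descProd s j m * s (l + 1) := by
  rw [← descProd_mul (s := s) (hj.trans (by omega : l ≤ l + 2)) hl,
    descProd_succ (by omega : j ≤ l + 1), descProd_succ hj, ← mul_assoc,
    commute_descProd fun i hi hi' => hs.comm l i hi (by omega)]
  have h1 := hs.braid l (by omega)
  have h2 : s (l + 1) * descProd s j l = descProd s j l * s (l + 1) :=
    commute_descProd fun i hi hi' => (hs.comm i (l + 1) (by omega) (by omega)).symm
  simp only [mul_assoc] at h1 ⊢
  rw [← h2]
  congr 1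
  simp only [← mul_assoc] at h1 ⊢
  rw [h1]

/-- A product of the first `m` involutions of a braid sequence is in normal form. -/
theorem IsBraidSequence.exists_eq_mul_descProd {n : ℕ} (hs : IsBraidSequence n s)
    (hsq : ∀ i, i + 1 < n → s i * s i = 1) {m : ℕ} (hm : m < n) {w : W}
    (hw : w ∈ Subgroup.closure {g | ∃ i, i < m ∧ g = s i}) :
    ∃ u ∈ Subgroup.closure {g | ∃ i, i + 1 < m ∧ g = s i}, ∃ j ≤ m, w = u * descProd s j m := by
  have step : ∀ x : W, (∃ u ∈ Subgroup.closure {g | ∃ i, i + 1 < m ∧ g = s i},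
      ∃ j ≤ m, x = u * descProd s j m) → ∀ i < m,
      (∃ u ∈ Subgroup.closure {g | ∃ i, i + 1 < m ∧ g = s i},
        ∃ j ≤ m, x * s i = u * descProd s j m) := by
    rintro x ⟨u, hu, j, hj, rfl⟩ i hi
    -- Right multiplication by `s i` shifts the descending factor or is absorbed by `u`: for `i < j
    -- - 1` it commutes into `u`, for `i = j - 1` it lengthens the factor, for `i = j` it cancels
    -- its last letter, and for `i > j` it enters `u` as `s (i - 1)`.
    rcases lt_trichotomy i j with hij | rfl | hij
    · rcases Nat.lt_or_ge (i + 1) j with h | h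
      · refine ⟨u * s i, mul_mem hu (Subgroup.subset_closure ⟨i, by omega, rfl⟩), j, hj, ?_⟩
        rw [mul_assoc, mul_assoc,
          commute_descProd fun l hl hl' => hs.comm i l (by omega) (by omega)]
      · obtain rfl : j = i + 1 := by omega
        exact ⟨u, hu, i, hi.le, by rw [mul_assoc, ← descProd_eq_mul hi]⟩
    · exact ⟨u, hu, i + 1, hi, by
        rw [descProd_eq_mul hi, mul_assoc, mul_assoc, hsq i (by omega), mul_one]⟩
    · obtain ⟨l, rfl⟩ : ∃ l, i = l + 1 := ⟨i - 1, by omega⟩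
      refine ⟨u * s l, mul_mem hu (Subgroup.subset_closure ⟨l, hi, rfl⟩), j, hj, ?_⟩
      rw [mul_assoc, mul_assoc, hs.mul_descProd (by omega) (by omega) hm]
  induction hw using Subgroup.closure_induction_right with
  | one => exact ⟨1, one_mem _, m, le_rfl, by simp⟩
  | mul_right x hx y hy ih =>
    obtain ⟨i, hi, rfl⟩ := hy
    exact step x ih i hi
  | mul_inv_cancel x hx y hy ih =>
    obtain ⟨i, hi, rfl⟩ := hy
    rw [inv_eq_of_mul_eq_one_left (hsq i (by omega))]
    exact step x ih i hi

theorem unop_descProd_apply {n : ℕ} (f : W →* (Equiv.Perm (Fin n))ᵐᵒᵖ)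
    (hf : ∀ i (h : i + 1 < n), f (s i) = MulOpposite.op (Equiv.swap ⟨i, by omega⟩ ⟨i + 1, h⟩))
    {j m : ℕ} (hj : j ≤ m) (hm : m < n) :
    (f (descProd s j m)).unop ⟨m, hm⟩ = ⟨j, hj.trans_lt hm⟩ := by
  induction m, hj using Nat.le_induction with
  | base => simp
  | succ m hm' ih =>
    rw [descProd_succ hm', map_mul, MulOpposite.unop_mul, Equiv.Perm.mul_apply, hf m hm,
      MulOpposite.unop_op, Equiv.swap_apply_right]
    exact ih (by omega)

/-- The symmetric group is defined by the Coxeter relations: a homomorphism to it which sends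
involutions satisfying the braid relations to the adjacent transpositions is injective on the
subgroup they generate. -/
theorem IsBraidSequence.eq_one_of_map_eq_one {n : ℕ} (hs : IsBraidSequence n s)
    (hsq : ∀ i, i + 1 < n → s i * s i = 1) (f : W →* (Equiv.Perm (Fin n))ᵐᵒᵖ)
    (hf : ∀ i (h : i + 1 < n), f (s i) = MulOpposite.op (Equiv.swap ⟨i, by omega⟩ ⟨i + 1, h⟩))
    {m : ℕ} (hm : m ≤ n) {w : W} (hw : w ∈ Subgroup.closure {g | ∃ i, i + 1 < m ∧ g = s i})
    (hfw : f w = 1) : w = 1 := by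
  induction m generalizing w with
  | zero => simpa using hw
  | succ m ih =>
    simp only [Nat.add_lt_add_iff_right] at hw
    obtain ⟨u, hu, j, hj, rfl⟩ := hs.exists_eq_mul_descProd hsq hm hw
    -- `u` involves only transpositions of points below `m`. The descending factor carries `m` to
    -- `j`, so triviality of the image forces `j = m`, and `w = u` falls to the induction.
    have hfix : (f u).unop ⟨m, hm⟩ = ⟨m, hm⟩ := by
      have : f u ∈ (MulAction.stabilizer (Equiv.Perm (Fin n)) (⟨m, hm⟩ : Fin n)).op := by
        refine (Subgroup.closure_le ((MulAction.stabilizer _ _).op.comap f)).2 ?_ hu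
        rintro _ ⟨i, hi, rfl⟩
        simp only [Subgroup.coe_comap, Set.mem_preimage, SetLike.mem_coe, Subgroup.mem_op,
          hf i (by omega), MulOpposite.unop_op, MulAction.mem_stabilizer_iff,
          Equiv.Perm.smul_def]
        exact Equiv.swap_apply_of_ne_of_ne (by simp only [ne_eq, Fin.ext_iff]; omega)
          (by simp only [ne_eq, Fin.ext_iff]; omega)
      exact this
    have hjm : j = m := by
      have h := congrArg (fun g : (Equiv.Perm (Fin n))ᵐᵒᵖ => g.unop ⟨m, hm⟩) hfw
      simp only [map_mul, MulOpposite.unop_mul, Equiv.Perm.mul_apply, hfix,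
        unop_descProd_apply f hf hj hm] at h
      simpa using h
    subst hjm
    rw [descProd_self, mul_one] at hfw ⊢
    exact ih (by omega) hu hfw

end Descending

/-! ### The `A_{i,j}` generate the kernel. -/

theorem isBraidSequence_quotGen (n : ℕ) : IsBraidSequence n (quotGen n) :=
  ⟨fun _ h => quotGen_braid h, fun _ _ h hj => quotGen_comm h hj⟩

theorem pureGen_eq (n i j : ℕ) : pureGen n i j =
    descProd (quotGen n) (i + 1) j * quotGen n i ^ 2 * (descProd (quotGen n) (i + 1) j)⁻¹ := by
  rw [pureGen, bandConj, descProd, Nat.sub_sub, add_comm 1 i]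

theorem strandPerm_quotGen_sq {n i : ℕ} (h : i + 1 < n) : strandPerm (quotGen n i ^ 2) = 1 := by
  rw [strandPerm_pow, strandPerm_quotGen h, sq, Equiv.swap_mul_self]

theorem strandPerm_pureGen {n i j : ℕ} (hij : i < j) (hj : j < n) :
    strandPerm (pureGen n i j) = 1 := by
  rw [pureGen_eq, strandPerm_mul, strandPerm_mul, strandPerm_quotGen_sq (by omega),
    strandPerm_inv, one_mul, inv_mul_cancel]

/-- `σ_k ^ 2` lies in the abelian kernel, so conjugation by `σ_k` is an involution there. Only one
direction of conjugation then needs to be computed. -/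
theorem quotGen_conj_symm {n k : ℕ} (hk : k + 1 < n) {x : BraidQuotient n}
    (hx : strandPerm x = 1) :
    (quotGen n k)⁻¹ * x * quotGen n k = quotGen n k * x * (quotGen n k)⁻¹ := by
  have := mul_comm_of_strandPerm_eq_one hx (strandPerm_quotGen_sq hk)
  rw [eq_mul_inv_iff_mul_eq, mul_assoc, mul_assoc, ← sq, this, sq]
  group

theorem quotGen_conj_pureGen_top {n i j : ℕ} (hij : i < j) :
    quotGen n j * pureGen n i j * (quotGen n j)⁻¹ = pureGen n i (j + 1) := by
  rw [pureGen_eq, pureGen_eq, descProd_succ hij]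
  group

theorem quotGen_conj_pureGen_bot {n i j : ℕ} (hij : i + 1 < j) (hj : j < n) :
    quotGen n i * pureGen n i j * (quotGen n i)⁻¹ = pureGen n (i + 1) j := by
  have h1 : quotGen n i * descProd (quotGen n) (i + 2) j =
      descProd (quotGen n) (i + 2) j * quotGen n i :=
    commute_descProd fun l hl hl' => quotGen_comm hl (by omega)
  have h2 : quotGen n i * quotGen n (i + 1) * quotGen n i ^ 2 =
      quotGen n (i + 1) ^ 2 * (quotGen n i * quotGen n (i + 1)) := by
    have h := quotGen_braid (n := n) (i := i) (by omega)
    rw [sq, ← mul_assoc, h, mul_assoc (_ * _), ← mul_assoc, sq]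
    simp only [mul_assoc] at h ⊢
    rw [← h]
  rw [pureGen_eq, pureGen_eq, descProd_eq_mul hij]
  generalize descProd (quotGen n) (i + 2) j = d at h1 ⊢
  have h3 : quotGen n i * (d * quotGen n (i + 1)) = d * (quotGen n i * quotGen n (i + 1)) := by
    rw [← mul_assoc, h1, mul_assoc]
  rw [mul_inv_eq_iff_eq_mul, ← mul_assoc, ← mul_assoc, mul_inv_eq_iff_eq_mul]
  rw [mul_assoc _ (quotGen n i) (d * _), h3]
  simp only [mul_assoc] at h2 ⊢
  rw [inv_mul_cancel_left, h2]

/-- Conjugation by `σ_k` acts on labels as the transposition of `k` and `k + 1`. If this preserves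
the pair, `σ_k` commutes with `A_{i,j}`: it passes the conjugating word as some `σ_l` that commutes
with `σ_i`. -/
theorem exists_quotGen_conj_pureGen {n i j k : ℕ} (hij : i < j) (hj : j < n) (hk : k + 1 < n) :
    ∃ i' j', i' < j' ∧ j' < n ∧
      quotGen n k * pureGen n i j * (quotGen n k)⁻¹ = pureGen n i' j' := by
  have hcomm : quotGen n k * pureGen n i j = pureGen n i j * quotGen n k →
      ∃ i' j', i' < j' ∧ j' < n ∧
        quotGen n k * pureGen n i j * (quotGen n k)⁻¹ = pureGen n i' j' := fun h =>
    ⟨i, j, hij, hj, by rw [h, mul_inv_cancel_right]⟩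
  have hconj : ∀ d : BraidQuotient n, ∀ l, quotGen n k * d = d * quotGen n l →
      quotGen n l * quotGen n i = quotGen n i * quotGen n l →
      quotGen n k * (d * quotGen n i ^ 2 * d⁻¹) = d * quotGen n i ^ 2 * d⁻¹ * quotGen n k := by
    intro d l h1 h2
    have h3 : Commute (quotGen n l) (quotGen n i ^ 2) := Commute.pow_right h2 2
    have h4 : quotGen n k = d * quotGen n l * d⁻¹ := by rw [← h1, mul_inv_cancel_right]
    rw [h4]
    simp only [mul_assoc, inv_mul_cancel_left]
    rw [← mul_assoc (quotGen n l), h3.eq, mul_assoc]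
  rcases lt_trichotomy k j with hkj | rfl | hkj
  · rcases Nat.lt_or_ge (k + 1) j with hkj' | hkj'
    · rcases lt_trichotomy k i with hki | rfl | hki
      · rcases Nat.lt_or_ge (k + 1) i with hki' | hki'
        · refine hcomm ?_
          rw [pureGen_eq]
          exact hconj _ k (commute_descProd fun l hl hl' => quotGen_comm (by omega) (by omega))
            (quotGen_comm (by omega) (by omega))
        · obtain rfl : i = k + 1 := by omega
          refine ⟨k, j, by omega, hj, ?_⟩
          rw [← quotGen_conj_symm hk (strandPerm_pureGen hij hj),
            ← quotGen_conj_pureGen_bot hij hj]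
          group
      · exact ⟨k + 1, j, hkj', hj, quotGen_conj_pureGen_bot hkj' hj⟩
      · refine hcomm ?_
        rw [pureGen_eq]
        exact hconj _ (k + 1)
          ((isBraidSequence_quotGen n).mul_descProd (by omega) (by omega) hj)
          (quotGen_comm (by omega) (by omega)).symm
    · obtain rfl : j = k + 1 := by omega
      rcases Nat.lt_or_ge i k with hik | hik
      · refine ⟨i, k, hik, by omega, ?_⟩
        rw [← quotGen_conj_symm hk (strandPerm_pureGen hij hj), ← quotGen_conj_pureGen_top hik]
        group
      · obtain rfl : i = k := by omega
        refine hcomm ?_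
        rw [pureGen_eq, descProd_self]
        exact hconj 1 i (by simp) rfl
  · exact ⟨i, k + 1, by omega, hk, quotGen_conj_pureGen_top hij⟩
  · refine hcomm ?_
    rw [pureGen_eq]
    exact hconj _ k (commute_descProd fun l hl hl' => (quotGen_comm (by omega) (by omega)).symm)
      (quotGen_comm (by omega) (by omega)).symm

/-- The subgroup of `B_n / [P_n, P_n]` generated by the `A_{i,j}`. -/
def pureSubgroup (n : ℕ) : Subgroup (BraidQuotient n) :=
  Subgroup.closure {g | ∃ i j, i < j ∧ j < n ∧ g = pureGen n i j}

theorem pureGen_mem_pureSubgroup {n i j : ℕ} (hij : i < j) (hj : j < n) :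
    pureGen n i j ∈ pureSubgroup n := Subgroup.subset_closure ⟨i, j, hij, hj, rfl⟩

theorem strandPerm_of_mem_pureSubgroup {n : ℕ} {x : BraidQuotient n} (hx : x ∈ pureSubgroup n) :
    strandPerm x = 1 := by
  induction hx using Subgroup.closure_induction with
  | mem x hx =>
    obtain ⟨i, j, hij, hj, rfl⟩ := hx
    exact strandPerm_pureGen hij hj
  | one => simp
  | mul x y _ _ hx hy => simp [hx, hy]
  | inv x _ hx => simp [hx]

theorem quotGen_conj_mem_pureSubgroup {n k : ℕ} (hk : k + 1 < n) {x : BraidQuotient n}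
    (hx : x ∈ pureSubgroup n) : quotGen n k * x * (quotGen n k)⁻¹ ∈ pureSubgroup n := by
  refine (Subgroup.closure_le ((pureSubgroup n).comap
    (MulAut.conj (quotGen n k)).toMonoidHom)).2 ?_ hx
  rintro _ ⟨i, j, hij, hj, rfl⟩
  obtain ⟨i', j', hij', hj', h⟩ := exists_quotGen_conj_pureGen hij hj hk
  change quotGen n k * pureGen n i j * (quotGen n k)⁻¹ ∈ pureSubgroup n
  rw [h]
  exact pureGen_mem_pureSubgroup hij' hj'

instance pureSubgroup_normal (n : ℕ) : (pureSubgroup n).Normal := by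
  rw [← Subgroup.normalizer_eq_top_iff, ← top_le_iff, ← closure_quotGen n, Subgroup.closure_le]
  rintro _ ⟨k, hk, rfl⟩
  refine Subgroup.mem_normalizer_iff.2 fun x => ⟨quotGen_conj_mem_pureSubgroup hk, fun hx => ?_⟩
  have := quotGen_conj_mem_pureSubgroup hk hx
  rw [← quotGen_conj_symm hk (strandPerm_of_mem_pureSubgroup hx)] at this
  simpa [mul_assoc] using this

/-- The `A_{i,j}` generate the image of the pure braid group. -/
theorem mem_pureSubgroup_of_strandPerm_eq_one {n : ℕ} {x : BraidQuotient n}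
    (hx : strandPerm x = 1) : x ∈ pureSubgroup n := by
  have hle : pureSubgroup n ≤ (braidQuotientPerm n).ker := fun y hy =>
    MulOpposite.unop_injective (strandPerm_of_mem_pureSubgroup hy)
  have hs : IsBraidSequence n fun i => (quotGen n i : BraidQuotient n ⧸ pureSubgroup n) :=
    ⟨fun i h => congrArg (QuotientGroup.mk' (pureSubgroup n)) (quotGen_braid h),
      fun i j h hj => congrArg (QuotientGroup.mk' (pureSubgroup n)) (quotGen_comm h hj)⟩
  rw [← QuotientGroup.eq_one_iff]
  -- Modulo the `A_{i,j}` each `σ_i` is an involution, since `σ_i ^ 2 = A_{i,i+1}`; the Coxeter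
  -- argument therefore applies to the quotient.
  refine hs.eq_one_of_map_eq_one ?_
    (QuotientGroup.lift (pureSubgroup n) (braidQuotientPerm n) fun y hy => hle hy) ?_ le_rfl ?_ ?_
  · intro i hi
    rw [← QuotientGroup.mk_mul, QuotientGroup.eq_one_iff, ← sq]
    have := pureGen_mem_pureSubgroup (Nat.lt_succ_self i) hi
    rwa [pureGen_eq, descProd_self, one_mul, inv_one, mul_one] at this
  · intro i hi
    rw [QuotientGroup.lift_mk, braidQuotientPerm_eq, strandPerm_quotGen hi]
  · have h : x ∈ Subgroup.closure {g : BraidQuotient n | ∃ i, i + 1 < n ∧ g = quotGen n i} := by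
      rw [closure_quotGen]; exact Subgroup.mem_top x
    have h' := Subgroup.mem_map_of_mem (QuotientGroup.mk' (pureSubgroup n)) h
    rw [MonoidHom.map_closure] at h'
    refine Subgroup.closure_mono ?_ h'
    rintro _ ⟨_, ⟨i, hi, rfl⟩, rfl⟩
    exact ⟨i, hi, rfl⟩
  · rw [QuotientGroup.lift_mk, braidQuotientPerm_eq, hx, MulOpposite.op_one]

/-! ### The kernel as a free abelian group. -/

/-- The kernel of `B_n / [P_n, P_n] → S_n`. -/
def pureKernel (n : ℕ) : Subgroup (BraidQuotient n) := (braidQuotientPerm n).ker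

theorem mem_pureKernel {n : ℕ} {g : BraidQuotient n} : g ∈ pureKernel n ↔ strandPerm g = 1 :=
  MulOpposite.unop_eq_one_iff _ |>.symm

instance pureKernelCommGroup (n : ℕ) : CommGroup (pureKernel n) :=
  { (inferInstance : Group (pureKernel n)) with
    mul_comm := fun x y => Subtype.ext
      (mul_comm_of_strandPerm_eq_one (mem_pureKernel.1 x.2) (mem_pureKernel.1 y.2)) }

/-- The generator `A_{i,j}` as an element of the kernel, for `i < j` (and `1` otherwise). -/
def pureKernelGen (n : ℕ) (i j : Fin n) : pureKernel n :=
  if h : i < j then ⟨pureGen n i j, mem_pureKernel.2 (strandPerm_pureGen h j.2)⟩ else 1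

/-- The product of the `A_{i,j} ^ x_{i,j}` in the kernel. -/
def pureKernelProd (n : ℕ) (x : Sym2 (Fin n) → ℤ) : pureKernel n :=
  ∏ i, ∏ j, pureKernelGen n i j ^ x s(i, j)

theorem prod_map_filter_eq {M α : Type*} [Monoid M] (l : List α) (q : α → Prop) [DecidablePred q]
    (f : α → M) :
    ((l.filter fun a => q a).map f).prod = (l.map fun a => if q a then f a else 1).prod := by
  induction l with
  | nil => rfl
  | cons a l ih => by_cases h : q a <;> simp [h, ih]

/-- Passes from the ordered product to an unordered one in a commutative group, where additivity in
the exponents is immediate. -/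
theorem coe_pureKernelProd (n : ℕ) (x : Sym2 (Fin n) → ℤ) :
    (pureKernelProd n x : BraidQuotient n) = pureProd n x := by
  have h : ∀ i j : Fin n, ((pureKernelGen n i j ^ x s(i, j) : pureKernel n) : BraidQuotient n) =
      if i < j then pureGen n i j ^ x s(i, j) else 1 := by
    intro i j
    by_cases h : i < j <;> simp [pureKernelGen, h]
  simp only [pureKernelProd, pureProd, Fin.prod_univ_def, Subgroup.val_list_prod, List.map_map,
    List.flatMap_def, List.prod_flatten]
  congr 2
  ext i
  simp only [Function.comp_apply, Subgroup.val_list_prod, List.map_map, prod_map_filter_eq]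
  congr 2
  ext j
  exact h i j

theorem pureKernelProd_add (n : ℕ) (x y : Sym2 (Fin n) → ℤ) :
    pureKernelProd n (x + y) = pureKernelProd n x * pureKernelProd n y := by
  simp [pureKernelProd, zpow_add, Finset.prod_mul_distrib]

theorem pureKernelProd_neg (n : ℕ) (x : Sym2 (Fin n) → ℤ) :
    pureKernelProd n (-x) = (pureKernelProd n x)⁻¹ := by
  simp [pureKernelProd, Finset.prod_inv_distrib]

theorem pureKernelProd_eq_one {n : ℕ} {x : Sym2 (Fin n) → ℤ}
    (hx : ∀ i j : Fin n, i < j → x s(i, j) = 0) : pureKernelProd n x = 1 := by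
  refine Finset.prod_eq_one fun i _ => Finset.prod_eq_one fun j _ => ?_
  by_cases h : i < j
  · rw [hx i j h, zpow_zero]
  · simp [pureKernelGen, h]

theorem pureKernelProd_single {n : ℕ} {a b : Fin n} (hab : a < b) :
    pureKernelProd n (fun e => if e = s(a, b) then 1 else 0) = pureKernelGen n a b := by
  have h0 : ∀ i j : Fin n, ¬ (i = a ∧ j = b) →
      pureKernelGen n i j ^ (if s(i, j) = s(a, b) then (1 : ℤ) else 0) = 1 := by
    intro i j hij
    by_cases hlt : i < j
    · rw [if_neg, zpow_zero]
      rw [Sym2.eq_iff]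
      rintro (h | ⟨rfl, rfl⟩)
      · exact hij h
      · exact lt_asymm hab hlt
    · simp [pureKernelGen, hlt]
  rw [pureKernelProd, Finset.prod_eq_single a, Finset.prod_eq_single b]
  · simp
  · exact fun j _ hj => h0 a j fun h => hj h.2
  · simp
  · exact fun i _ hi => Finset.prod_eq_one fun j _ => h0 i j fun h => hi h.1
  · simp

theorem exists_eq_pureProd {n : ℕ} {g : BraidQuotient n} (hg : strandPerm g = 1) :
    ∃ c, g = pureProd n c := by
  have h := mem_pureSubgroup_of_strandPerm_eq_one hg
  induction h using Subgroup.closure_induction with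
  | mem x hx =>
    obtain ⟨i, j, hij, hj, rfl⟩ := hx
    refine ⟨_, Eq.trans ?_ ((congrArg Subtype.val (pureKernelProd_single (a := ⟨i, hij.trans hj⟩)
      (b := ⟨j, hj⟩) hij)).symm.trans (coe_pureKernelProd n _))⟩
    rw [pureKernelGen, dif_pos (by exact hij)]
  | one => exact ⟨0, by rw [← coe_pureKernelProd, pureKernelProd_eq_one (by simp)]; rfl⟩
  | mul x y hx hy ihx ihy =>
    obtain ⟨c, rfl⟩ := ihx (strandPerm_of_mem_pureSubgroup hx)
    obtain ⟨d, rfl⟩ := ihy (strandPerm_of_mem_pureSubgroup hy)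
    refine ⟨c + d, ?_⟩
    simp only [← coe_pureKernelProd, pureKernelProd_add, Subgroup.coe_mul]
  | inv x hx ihx =>
    obtain ⟨c, rfl⟩ := ihx (strandPerm_of_mem_pureSubgroup hx)
    refine ⟨-c, ?_⟩
    simp only [← coe_pureKernelProd, pureKernelProd_neg, Subgroup.coe_inv]

@[simp]
theorem strandPerm_pureProd {n : ℕ} (x : Sym2 (Fin n) → ℤ) : strandPerm (pureProd n x) = 1 := by
  rw [← coe_pureKernelProd]
  exact mem_pureKernel.1 (pureKernelProd n x).2

theorem map_eq_mk_iff {α : Type*} (g : Equiv.Perm α) (e : Sym2 α) (a b : α) :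
    Sym2.map g e = s(g a, g b) ↔ e = s(a, b) := by
  rw [← Sym2.map_mk]
  exact (Sym2.map.injective g.injective).eq_iff

theorem crossNum_quotGen_sq {n i : ℕ} (h : i + 1 < n) (e : Sym2 (Fin n)) :
    crossNum (quotGen n i ^ 2) e = if e = s(⟨i, by omega⟩, ⟨i + 1, h⟩) then 2 else 0 := by
  have h1 := map_eq_mk_iff (Equiv.swap (⟨i, by omega⟩ : Fin n) ⟨i + 1, h⟩) e ⟨i, by omega⟩ ⟨i + 1, h⟩
  rw [Equiv.swap_apply_left, Equiv.swap_apply_right, Sym2.eq_swap] at h1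
  rw [sq, crossNum_mul, strandPerm_quotGen h, crossNum_quotGen h, crossNum_quotGen h]
  simp only [h1]
  split_ifs <;> rfl

theorem crossNum_conj {n : ℕ} (d : BraidQuotient n) {g : BraidQuotient n} (hg : strandPerm g = 1)
    (e : Sym2 (Fin n)) : crossNum (d * g * d⁻¹) e = crossNum g (Sym2.map (strandPerm d) e) := by
  simp [hg, Sym2.map_map]

theorem strandPerm_descProd_apply_of_lt {n i j k : ℕ} (hij : i + 1 ≤ j) (hj : j < n) (hk : k ≤ i) :
    strandPerm (descProd (quotGen n) (i + 1) j) ⟨k, by omega⟩ = ⟨k, by omega⟩ := by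
  induction j, hij using Nat.le_induction with
  | base => simp
  | succ m hm ih =>
    rw [descProd_succ hm, strandPerm_mul, Equiv.Perm.mul_apply, strandPerm_quotGen hj,
      Equiv.swap_apply_of_ne_of_ne (by simp only [ne_eq, Fin.ext_iff]; omega)
        (by simp only [ne_eq, Fin.ext_iff]; omega)]
    exact ih (by omega)

theorem strandPerm_descProd_apply_top {n i j : ℕ} (hij : i ≤ j) (hj : j < n) :
    strandPerm (descProd (quotGen n) i j) ⟨j, hj⟩ = ⟨i, by omega⟩ :=
  unop_descProd_apply (braidQuotientPerm n)
    (fun _ h => by rw [braidQuotientPerm_eq, strandPerm_quotGen h]) hij hj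

theorem crossNum_pureGen {n : ℕ} {i j : Fin n} (hij : i < j) (e : Sym2 (Fin n)) :
    crossNum (pureGen n i j) e = if e = s(i, j) then 2 else 0 := by
  have hi : (i : ℕ) + 1 < n := by omega
  rw [pureGen_eq, crossNum_conj _ (strandPerm_quotGen_sq hi), crossNum_quotGen_sq hi]
  -- Conjugation only relabels crossings: the conjugating word fixes string `i` and brings string
  -- `j` next to it, where `σ_i ^ 2` crosses the two twice.
  have h1 := strandPerm_descProd_apply_of_lt (i := i) (k := i) hij j.2 le_rfl
  have h2 := strandPerm_descProd_apply_top (i := i + 1) hij j.2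
  rw [← h2, ← h1]
  simp only [map_eq_mk_iff]

/-- Crossing numbers on the kernel, as a homomorphism. -/
def crossNumHom (n : ℕ) (e : Sym2 (Fin n)) : pureKernel n →* Multiplicative ℤ where
  toFun g := Multiplicative.ofAdd (crossNum (g : BraidQuotient n) e)
  map_one' := by simp
  map_mul' g h := by simp [mem_pureKernel.1 g.2]

theorem crossNumHom_pureKernelGen {n : ℕ} (i j : Fin n) (e : Sym2 (Fin n)) :
    crossNumHom n e (pureKernelGen n i j) =
      Multiplicative.ofAdd (if i < j ∧ e = s(i, j) then 2 else 0) := by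
  by_cases h : i < j
  · simp [crossNumHom, pureKernelGen, h, crossNum_pureGen h]
  · simp [pureKernelGen, h]

theorem crossNum_pureProd_eq_sum {n : ℕ} (x : Sym2 (Fin n) → ℤ) (e : Sym2 (Fin n)) :
    crossNum (pureProd n x) e =
      ∑ i, ∑ j, x s(i, j) * (if i < j ∧ e = s(i, j) then 2 else 0) := by
  have : crossNum (pureProd n x) e = (crossNumHom n e (pureKernelProd n x)).toAdd := by
    rw [← coe_pureKernelProd]; rfl
  rw [this, pureKernelProd]
  simp [map_prod, toAdd_prod, crossNumHom_pureKernelGen]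

theorem crossNum_pureProd {n : ℕ} (x : Sym2 (Fin n) → ℤ) (e : Sym2 (Fin n)) :
    crossNum (pureProd n x) e = if e.IsDiag then 0 else 2 * x e := by
  rw [crossNum_pureProd_eq_sum]
  split_ifs with h
  · refine Finset.sum_eq_zero fun i _ => Finset.sum_eq_zero fun j _ => ?_
    rw [if_neg, mul_zero]
    rintro ⟨hij, rfl⟩
    exact hij.ne h
  · have key : ∀ a b : Fin n, a < b →
        ∑ i, ∑ j, x s(i, j) * (if i < j ∧ s(a, b) = s(i, j) then 2 else 0) = 2 * x s(a, b) := by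
      intro a b hab
      have h0 : ∀ i j : Fin n, ¬ (i = a ∧ j = b) →
          x s(i, j) * (if i < j ∧ s(a, b) = s(i, j) then 2 else 0) = 0 := by
        intro i j hij
        rw [if_neg, mul_zero]
        rintro ⟨hlt, h⟩
        rcases Sym2.eq_iff.1 h with ⟨rfl, rfl⟩ | ⟨rfl, rfl⟩
        · exact hij ⟨rfl, rfl⟩
        · exact lt_asymm hab hlt
      rw [Finset.sum_eq_single a, Finset.sum_eq_single b]
      · simp [hab, mul_comm]
      · exact fun j _ hj => h0 a j fun h => hj h.2
      · simp
      · exact fun i _ hi => Finset.sum_eq_zero fun j _ => h0 i j fun h => hi h.1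
      · simp
    induction e with
    | _ a b =>
      rcases lt_trichotomy a b with hab | hab | hab
      · exact key a b hab
      · exact absurd hab h
      · rw [Sym2.eq_swap]; exact key b a hab

/-- Elements of `B_n / [P_n, P_n]` are determined by their permutation and crossing numbers. -/
theorem braidQuotient_ext {n : ℕ} {g h : BraidQuotient n} (hp : strandPerm g = strandPerm h)
    (hc : ∀ e, crossNum g e = crossNum h e) : g = h := by
  have h1 : strandPerm (g * h⁻¹) = 1 := by simp [hp]
  obtain ⟨c, h2⟩ := exists_eq_pureProd h1
  rw [← mul_inv_eq_one, h2, ← coe_pureKernelProd, pureKernelProd_eq_one, Subgroup.coe_one]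
  intro i j hij
  have h3 : crossNum (g * h⁻¹) s(i, j) = 0 := by simp [hp, hc]
  rw [h2, crossNum_pureProd, if_neg (by exact hij.ne)] at h3
  linarith

/-! ### Coboundaries for a permutation of finite order. -/

/-- The action of permutations on unordered pairs. -/
def pairPerm (α : Type*) : Equiv.Perm α →* Equiv.Perm (Sym2 α) :=
  MonoidHom.toHomPerm
    { toFun := fun g => Sym2.map g
      map_one' := Sym2.map_id
      map_mul' := fun g h => (Sym2.map_comp : Sym2.map (g ∘ h) = _) }

@[simp]
theorem pairPerm_apply {α : Type*} (g : Equiv.Perm α) (e : Sym2 α) :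
    pairPerm α g e = Sym2.map g e := rfl

theorem pairPerm_pow_apply {α : Type*} (g : Equiv.Perm α) (t : ℕ) (e : Sym2 α) :
    (pairPerm α g ^ t) e = Sym2.map (g ^ t : Equiv.Perm α) e := by
  rw [← map_pow, pairPerm_apply]

section Coboundary

variable {E : Type*} (T : Equiv.Perm E) (c : E → ℤ)

theorem sum_orbit_add (u : E) (a b : ℕ) : ∑ t ∈ Finset.range (a + b), c ((T ^ t) u) =
    ∑ t ∈ Finset.range a, c ((T ^ t) u) + ∑ t ∈ Finset.range b, c ((T ^ t) ((T ^ a) u)) := by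
  rw [Finset.sum_range_add]
  congr 1
  refine Finset.sum_congr rfl fun t _ => ?_
  rw [← Equiv.Perm.mul_apply, ← pow_add, add_comm]

theorem sum_orbit_mul {u : E} {a : ℕ} (h : (T ^ a) u = u) (b : ℕ) :
    ∑ t ∈ Finset.range (a * b), c ((T ^ t) u) = b * ∑ t ∈ Finset.range a, c ((T ^ t) u) := by
  induction b with
  | zero => simp
  | succ b ih =>
    rw [Nat.mul_succ, add_comm, sum_orbit_add, h, ih]
    push_cast
    ring

/-- A function whose sums over the orbits of a permutation of finite order vanish is a
coboundary. -/
theorem exists_coboundary {N : ℕ} (hN : 0 < N) (hT : T ^ N = 1)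
    (hc : ∀ e, ∑ t ∈ Finset.range N, c ((T ^ t) e) = 0) :
    ∃ x : E → ℤ, ∀ e, x (T e) = x e + c e := by
  -- Summing over `N * d` steps in two ways gives `N` times the sum over `d` steps and `d` times the
  -- vanishing sum over `N` steps.
  have hzero : ∀ u d, (T ^ d) u = u → ∑ t ∈ Finset.range d, c ((T ^ t) u) = 0 := by
    intro u d hd
    have h1 := sum_orbit_mul T c hd N
    have h2 := sum_orbit_mul T c (u := u) (a := N) (by rw [hT]; rfl) d
    rw [mul_comm d N, h2, hc, mul_zero] at h1
    exact (mul_eq_zero.1 h1.symm).resolve_left (by exact_mod_cast hN.ne')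
  have hwd' : ∀ u s d, (T ^ s) u = (T ^ (s + d)) u →
      ∑ t ∈ Finset.range s, c ((T ^ t) u) = ∑ t ∈ Finset.range (s + d), c ((T ^ t) u) := by
    intro u s d h
    rw [sum_orbit_add, hzero ((T ^ s) u) d, add_zero]
    rw [← Equiv.Perm.mul_apply, ← pow_add, add_comm, ← h]
  have hwd : ∀ u s s', (T ^ s) u = (T ^ s') u →
      ∑ t ∈ Finset.range s, c ((T ^ t) u) = ∑ t ∈ Finset.range s', c ((T ^ t) u) := by
    intro u s s' h
    rcases le_total s s' with hs | hs
    · obtain ⟨d, rfl⟩ := Nat.exists_eq_add_of_le hs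
      exact hwd' u s d h
    · obtain ⟨d, rfl⟩ := Nat.exists_eq_add_of_le hs
      exact (hwd' u s' d h.symm).symm
  -- With a base point chosen on each cycle, `x e` is the sum of `c` along a path from the base
  -- point to `e`; by `hwd` it depends only on the endpoint.
  let r : E → E := fun e => (Quotient.mk (Equiv.Perm.SameCycle.setoid T) e).out
  have hr : ∀ e, ∃ t : ℕ, (T ^ t) (r e) = e := by
    intro e
    obtain ⟨z, hz⟩ : T.SameCycle (r e) e :=
      Quotient.exact (s := Equiv.Perm.SameCycle.setoid T) (Quotient.out_eq _)
    refine ⟨(z % N).toNat, ?_⟩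
    have hnn : 0 ≤ z % (N : ℤ) := Int.emod_nonneg _ (by exact_mod_cast hN.ne')
    have : T ^ (z % (N : ℤ)).toNat = T ^ z := by
      rw [← zpow_natCast, Int.toNat_of_nonneg hnn]
      conv_rhs => rw [← Int.emod_add_mul_ediv z N, zpow_add, zpow_mul, zpow_natCast, hT, one_zpow,
        mul_one]
    rw [this, hz]
  choose τ hτ using hr
  refine ⟨fun e => ∑ t ∈ Finset.range (τ e), c ((T ^ t) (r e)), fun e => ?_⟩
  have hre : r (T e) = r e :=
    congrArg Quotient.out (Quotient.sound (s := Equiv.Perm.SameCycle.setoid T)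
      (show T.SameCycle (T e) e from Equiv.Perm.sameCycle_apply_left.2 (Equiv.Perm.SameCycle.refl T e)))
  have h1 : (T ^ τ (T e)) (r e) = (T ^ (τ e + 1)) (r e) := by
    rw [← hre, hτ, hre, pow_succ', Equiv.Perm.mul_apply, hτ]
  change ∑ t ∈ Finset.range (τ (T e)), c ((T ^ t) (r (T e))) = _
  rw [hre, hwd _ _ _ h1, Finset.sum_range_succ, hτ]

end Coboundary

/-! ### The semidirect product and maps out of it. -/

section Semidirect

variable {p k : ℕ} (h : k.Coprime p)

theorem genA_pow_self : genA p k h ^ p = 1 := by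
  rw [genA, ← map_pow, ← ofAdd_nsmul]
  simp

theorem genB_conj_genA : genB p k h * genA p k h * (genB p k h)⁻¹ = genA p k h ^ k := by
  have := SemidirectProduct.inl_aut
    (φ := zpowersHom (MulAut (Multiplicative (ZMod p))) (alphaAut p k h))
    (Multiplicative.ofAdd 1) (Multiplicative.ofAdd 1)
  rw [map_inv] at this
  rw [genA, genB, ← this, ← map_pow]
  congr 1

theorem eq_genA_pow_mul_genB_zpow [NeZero p] (g : ZpSemidirectZ p k h) :
    g = genA p k h ^ (g.left.toAdd.val) * genB p k h ^ g.right.toAdd := by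
  conv_lhs => rw [← SemidirectProduct.inl_left_mul_inr_right g]
  rw [genA, genB, ← map_pow, ← map_zpow, ← ofAdd_nsmul, ← ofAdd_zsmul]
  simp

/-- The universal property of the semidirect product. -/
theorem exists_semidirect_lift {G : Type*} [Group G] {a b : G} (ha : a ^ p = 1)
    (hab : b * a * b⁻¹ = a ^ k) :
    ∃ f : ZpSemidirectZ p k h →* G, f (genA p k h) = a ∧ f (genB p k h) = b := by
  let fa : Multiplicative (ZMod p) →* G := AddMonoidHom.toMultiplicativeLeft
    (ZMod.lift p ⟨zmultiplesHom (Additive G) (Additive.ofMul a), by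
      simp [← ofMul_pow, ha]⟩)
  have hfa : ∀ z : ℤ, fa (Multiplicative.ofAdd (z : ZMod p)) = a ^ z := fun z => by
    simp [fa, ← ofMul_zpow]
  have hfa1 : fa (Multiplicative.ofAdd 1) = a := by simpa using hfa 1
  have hconj : ∀ x, fa (alphaAut p k h x) = b * fa x * b⁻¹ := by
    intro x
    obtain ⟨z, hz⟩ := ZMod.intCast_surjective x.toAdd
    obtain rfl : x = Multiplicative.ofAdd (z : ZMod p) := by rw [hz]; rfl
    change fa (Multiplicative.ofAdd (z : ZMod p) ^ k) = _
    rw [map_pow, hfa, ← conj_zpow, hab, ← zpow_natCast, ← zpow_natCast, zpow_comm]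
  have hconj' : ∀ (z : ℤ) x, fa ((alphaAut p k h ^ z) x) = b ^ z * fa x * (b ^ z)⁻¹ := by
    intro z
    induction z using Int.induction_on with
    | zero => simp
    | succ i ih =>
      intro x
      rw [zpow_add_one, MulAut.mul_apply, ih, hconj]
      group
    | pred i ih =>
      intro x
      have h1 := hconj ((alphaAut p k h)⁻¹ x)
      rw [MulAut.apply_inv_self] at h1
      rw [zpow_sub_one, MulAut.mul_apply, ih, h1]
      group
  refine ⟨SemidirectProduct.lift fa (zpowersHom G b) fun g => ?_, ?_, ?_⟩
  · ext x
    exact hconj' g.toAdd x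
  · rw [genA, SemidirectProduct.lift_inl, hfa1]
  · rw [genB, SemidirectProduct.lift_inr]
    simp [zpowersHom_apply]

theorem semidirect_hom_ext [NeZero p] {G : Type*} [Group G] {f g : ZpSemidirectZ p k h →* G}
    (hA : f (genA p k h) = g (genA p k h)) (hB : f (genB p k h) = g (genB p k h)) : f = g := by
  ext1 x
  rw [eq_genA_pow_mul_genB_zpow h x]
  simp only [map_mul, map_pow, map_zpow, hA, hB]

theorem exists_presentation_equiv [NeZero p] :
    ∃ e : PresentedGroup (semidirectRels p k) ≃* ZpSemidirectZ p k h,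
      e (PresentedGroup.of 0) = genA p k h ∧ e (PresentedGroup.of 1) = genB p k h := by
  have hrel : ∀ r ∈ semidirectRels p k,
      FreeGroup.lift (![genA p k h, genB p k h] : Fin 2 → ZpSemidirectZ p k h) r = 1 := by
    rintro r (rfl | rfl)
    · simp [genA_pow_self]
    · simp only [map_mul, map_inv, map_pow, FreeGroup.lift_apply_of, mul_inv_eq_one]
      exact genB_conj_genA h
  let F : PresentedGroup (semidirectRels p k) →* ZpSemidirectZ p k h := PresentedGroup.toGroup hrel
  have hF0 : F (PresentedGroup.of 0) = genA p k h := PresentedGroup.toGroup.of hrel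
  have hF1 : F (PresentedGroup.of 1) = genB p k h := PresentedGroup.toGroup.of hrel
  have ha : (PresentedGroup.of 0 : PresentedGroup (semidirectRels p k)) ^ p = 1 :=
    PresentedGroup.one_of_mem (Or.inl rfl)
  have hab : (PresentedGroup.of 1 : PresentedGroup (semidirectRels p k)) * PresentedGroup.of 0 *
      (PresentedGroup.of 1)⁻¹ = PresentedGroup.of 0 ^ k :=
    mul_inv_eq_one.1 (PresentedGroup.one_of_mem (rels := semidirectRels p k) (Or.inr rfl))
  obtain ⟨f, hf0, hf1⟩ := exists_semidirect_lift h ha hab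
  refine ⟨MonoidHom.toMulEquiv F f ?_ ?_, hF0, hF1⟩
  · refine PresentedGroup.ext fun i => ?_
    fin_cases i
    · exact (congrArg f hF0).trans hf0
    · exact (congrArg f hF1).trans hf1
  · exact semidirect_hom_ext h ((congrArg F hf0).trans hF0) ((congrArg F hf1).trans hF1)

/-- A homomorphism from the semidirect product is injective if it preserves the order of `A` and
`B` is detected by an integer-valued homomorphism. -/
theorem semidirect_hom_injective [NeZero p] {G : Type*} [Group G] {f : ZpSemidirectZ p k h →* G}
    (hA : orderOf (f (genA p k h)) = p) (L : G →* Multiplicative ℤ)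
    (hB : L (f (genB p k h)) ≠ 1) : Function.Injective f := by
  rw [injective_iff_map_eq_one]
  intro g hg
  rw [eq_genA_pow_mul_genB_zpow h g, map_mul, map_pow, map_zpow] at hg
  -- `ℤ` has no torsion, so `L` kills the image of `A` and reads off the exponent of `B` alone.
  have hLA : L (f (genA p k h)) = 1 := by
    have h1 : (L (f (genA p k h))) ^ p = 1 := by
      rw [← map_pow, orderOf_dvd_iff_pow_eq_one.1 hA.dvd, map_one]
    exact (pow_eq_one_iff_left (NeZero.ne p)).1 h1
  have hb : g.right.toAdd = 0 := by
    have h1 := congrArg L hg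
    rw [map_mul, map_pow, map_zpow, hLA, one_pow, one_mul, map_one] at h1
    have h2 := congrArg Multiplicative.toAdd h1
    rw [toAdd_zpow, toAdd_one, smul_eq_mul, mul_eq_zero] at h2
    exact h2.resolve_right fun h3 => hB (Multiplicative.toAdd.injective h3)
  rw [hb, zpow_zero, mul_one] at hg
  have ha : g.left.toAdd.val = 0 := by
    have h1 := orderOf_dvd_of_pow_eq_one hg
    rw [hA] at h1
    exact Nat.eq_zero_of_dvd_of_lt h1 (ZMod.val_lt _)
  rw [eq_genA_pow_mul_genB_zpow h g, ha, hb, pow_zero, zpow_zero, mul_one]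

end Semidirect

/-! ### The permutation, crossing numbers and order of `δ_{0,p}`. -/

section SignedDescending

variable {n : ℕ} {s : ℕ → BraidQuotient n}

theorem val_strandPerm_descProd
    (hs : ∀ i (h : i + 1 < n), strandPerm (s i) = Equiv.swap ⟨i, by omega⟩ ⟨i + 1, h⟩)
    {j m : ℕ} (hj : j ≤ m) (hm : m < n) (a : Fin n) :
    (strandPerm (descProd s j m) a : ℕ) =
      if (a : ℕ) = m then j else if j ≤ a ∧ (a : ℕ) < m then a + 1 else a := by
  induction m, hj using Nat.le_induction generalizing a with
  | base => simp; grind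
  | succ m hm' ih =>
    rw [descProd_succ hm', strandPerm_mul, Equiv.Perm.mul_apply, ih (by omega), hs m hm]
    simp only [Equiv.swap_apply_def, Fin.ext_iff]
    grind

/-- Only the string starting at `m` crosses others: it moves down to `j` past each string in
between. The sign `ε` covers both the `σ_i` and their inverses. -/
theorem crossNum_descProd {ε : ℤ}
    (hs : ∀ i (h : i + 1 < n), strandPerm (s i) = Equiv.swap ⟨i, by omega⟩ ⟨i + 1, h⟩)
    (hc : ∀ i (h : i + 1 < n) e,
      crossNum (s i) e = if e = s(⟨i, by omega⟩, ⟨i + 1, h⟩) then ε else 0)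
    {j m : ℕ} (hj : j ≤ m) (hm : m < n) (a b : Fin n) :
    crossNum (descProd s j m) s(a, b) =
      if ((b : ℕ) = m ∧ j ≤ a ∧ (a : ℕ) < m) ∨ ((a : ℕ) = m ∧ j ≤ b ∧ (b : ℕ) < m)
        then ε else 0 := by
  induction m, hj using Nat.le_induction generalizing a b with
  | base =>
    rw [descProd_self, crossNum_one, if_neg]
    omega
  | succ m hm' ih =>
    rw [descProd_succ hm', crossNum_mul, hc m hm, hs m hm, Sym2.map_mk, ih (by omega)]
    simp only [Equiv.swap_apply_def, Fin.ext_iff, Sym2.eq_iff]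
    grind

end SignedDescending

theorem deltaElt_eq (n m : ℕ) : deltaElt n (2 * m + 1) =
    descProd (quotGen n) m (2 * m) * descProd (fun i => (quotGen n i)⁻¹) 0 m := by
  have h1 : (2 * m + 1) / 2 = m := by omega
  have h2 : 2 * m - m = m := by omega
  rw [deltaElt, descProd, descProd, h1, h2, List.range'_eq_map_range, List.range'_eq_map_range]
  simp [← List.map_reverse, Function.comp_def]

theorem strandPerm_quotGen_inv {n i : ℕ} (h : i + 1 < n) :
    strandPerm (quotGen n i)⁻¹ = Equiv.swap ⟨i, by omega⟩ ⟨i + 1, h⟩ := by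
  rw [strandPerm_inv, strandPerm_quotGen h, Equiv.swap_inv]

theorem crossNum_quotGen_inv {n i : ℕ} (h : i + 1 < n) (e : Sym2 (Fin n)) :
    crossNum (quotGen n i)⁻¹ e = if e = s(⟨i, by omega⟩, ⟨i + 1, h⟩) then -1 else 0 := by
  have h1 := map_eq_mk_iff (Equiv.swap (⟨i, by omega⟩ : Fin n) ⟨i + 1, h⟩) e ⟨i, by omega⟩ ⟨i + 1, h⟩
  rw [Equiv.swap_apply_left, Equiv.swap_apply_right, Sym2.eq_swap] at h1
  rw [crossNum_inv, strandPerm_quotGen h, Equiv.swap_inv, crossNum_quotGen h]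
  simp only [h1]
  split_ifs <;> rfl

theorem val_firstCycle_pow_of_lt {n p : ℕ} (hpn : p ≤ n) (t : ℕ) {a : Fin n} (ha : (a : ℕ) < p) :
    ((firstCycle n p ^ t) a : ℕ) = (a + t) % p := by
  have hlen : ((List.finRange n).take p).length = p := by simp [hpn]
  have h := List.formPerm_pow_apply_getElem ((List.finRange n).take p)
    ((List.nodup_finRange n).sublist (List.take_sublist _ _)) t a (by omega)
  have h1 : ((List.finRange n).take p)[(a : ℕ)]'(by omega) = a := by simp
  rw [h1] at h
  rw [firstCycle, h]
  simp [hpn]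

theorem firstCycle_pow_of_le {n p : ℕ} (t : ℕ) {a : Fin n} (ha : p ≤ a) :
    (firstCycle n p ^ t) a = a := by
  refine Function.IsFixedPt.perm_pow (List.formPerm_apply_of_notMem ?_) t
  intro h
  obtain ⟨i, hi, h⟩ := List.getElem_of_mem h
  simp only [List.length_take, List.length_finRange] at hi
  have := congrArg Fin.val h
  simp at this
  omega

theorem firstCycle_pow_self {n p : ℕ} (hpn : p ≤ n) : firstCycle n p ^ p = 1 := by
  have hlen : ((List.finRange n).take p).length = p := by simp [hpn]
  have h := List.formPerm_pow_length_eq_one_of_nodup _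
    ((List.nodup_finRange n).sublist (List.take_sublist p _))
  rwa [hlen] at h

theorem strandPerm_deltaElt {n m : ℕ} (hm : 2 * m + 1 ≤ n) :
    strandPerm (deltaElt n (2 * m + 1)) = firstCycle n (2 * m + 1) := by
  ext a
  rw [deltaElt_eq, strandPerm_mul, Equiv.Perm.mul_apply,
    val_strandPerm_descProd (fun _ h => strandPerm_quotGen_inv h) (Nat.zero_le m) (by omega),
    val_strandPerm_descProd (fun _ h => strandPerm_quotGen h) (by omega) (by omega)]
  rcases Nat.lt_or_ge a (2 * m + 1) with ha | ha
  · have h := val_firstCycle_pow_of_lt hm 1 ha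
    rw [pow_one] at h
    rw [h]
    rcases Nat.lt_or_ge a (2 * m) with ha' | ha'
    · rw [Nat.mod_eq_of_lt (by omega)]
      split_ifs <;> omega
    · obtain ha'' : (a : ℕ) = 2 * m := by omega
      rw [ha'', Nat.mod_self]
      split_ifs <;> omega
  · have h := firstCycle_pow_of_le 1 ha
    rw [pow_one] at h
    rw [h]
    split_ifs <;> omega

/-- The sign of the crossing of the last of `2 m + 1` strings with string `b` in `δ_{0,p}`. -/
def deltaSign (m b : ℕ) : ℤ := if b < m then -1 else if b < 2 * m then 1 else 0

/-- String `2 * m` passes strings `m, …, 2 * m - 1` positively, reaches position `m`, then passes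
strings `0, …, m - 1` negatively. -/
theorem crossNum_deltaElt {n m : ℕ} (hm : 2 * m + 1 ≤ n) (a b : Fin n) :
    crossNum (deltaElt n (2 * m + 1)) s(a, b) =
      (if (a : ℕ) = 2 * m then deltaSign m b else 0) +
        (if (b : ℕ) = 2 * m then deltaSign m a else 0) := by
  rw [deltaElt_eq, crossNum_mul, Sym2.map_mk,
    crossNum_descProd (fun _ h => strandPerm_quotGen h) (fun _ h => crossNum_quotGen h)
      (by omega) (by omega),
    crossNum_descProd (fun _ h => strandPerm_quotGen_inv h) (fun _ h => crossNum_quotGen_inv h)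
      (by omega) (by omega),
    val_strandPerm_descProd (fun _ h => strandPerm_quotGen h) (by omega) (by omega),
    val_strandPerm_descProd (fun _ h => strandPerm_quotGen h) (by omega) (by omega)]
  simp only [deltaSign]
  grind

/-- Along the orbit, string `a` occupies the last position `2 * m` exactly once, at time `2 * m -
a`. -/
theorem sum_deltaSign {m a b : ℕ} (ha : a < 2 * m + 1) :
    ∑ t ∈ Finset.range (2 * m + 1), (if (a + t) % (2 * m + 1) = 2 * m
      then deltaSign m ((b + t) % (2 * m + 1)) else 0) =
    deltaSign m ((b + (2 * m - a)) % (2 * m + 1)) := by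
  rw [Finset.sum_eq_single (2 * m - a)]
  · rw [if_pos]
    rw [Nat.add_sub_cancel' (by omega), Nat.mod_eq_of_lt (by omega)]
  · intro t ht hta
    rw [Finset.mem_range] at ht
    rw [if_neg]
    intro h
    rcases Nat.lt_or_ge (a + t) (2 * m + 1) with h1 | h1
    · rw [Nat.mod_eq_of_lt h1] at h; omega
    · rw [Nat.mod_eq_sub_mod h1, Nat.mod_eq_of_lt (by omega)] at h; omega
  · simp only [Finset.mem_range]; omega

/-- For `a ≠ b` the two residues add up to `2 * m - 1`, so exactly one is below `m` and the signs
are opposite. For `a = b` both equal `2 * m`, where the sign is 0. -/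
theorem deltaSign_add_deltaSign {m a b : ℕ} (ha : a < 2 * m + 1) (hb : b < 2 * m + 1) :
    deltaSign m ((b + (2 * m - a)) % (2 * m + 1)) +
      deltaSign m ((a + (2 * m - b)) % (2 * m + 1)) = 0 := by
  wlog hab : a ≤ b generalizing a b
  · rw [add_comm]; exact this hb ha (by omega)
  rw [Nat.mod_eq_of_lt (a := a + (2 * m - b)) (by omega)]
  rcases hab.eq_or_lt with rfl | hab
  · rw [Nat.mod_eq_of_lt (by omega)]
    simp only [deltaSign]
    split_ifs <;> omega
  · rw [Nat.mod_eq_sub_mod (by omega), Nat.mod_eq_of_lt (by omega)]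
    simp only [deltaSign]
    split_ifs <;> omega

theorem deltaElt_pow_self {n m : ℕ} (hm : 2 * m + 1 ≤ n) :
    deltaElt n (2 * m + 1) ^ (2 * m + 1) = 1 := by
  refine braidQuotient_ext ?_ fun e => ?_
  · rw [strandPerm_pow, strandPerm_deltaElt hm, firstCycle_pow_self hm, strandPerm_one]
  · induction e with
    | _ a b =>
      rw [crossNum_pow, crossNum_one, strandPerm_deltaElt hm]
      simp only [Sym2.map_mk, crossNum_deltaElt hm]
      rw [Finset.sum_add_distrib]
      have hfix : ∀ a b : Fin n, 2 * m + 1 ≤ a → ∀ t : ℕ,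
          (if ((firstCycle n (2 * m + 1) ^ t) a : ℕ) = 2 * m then
            deltaSign m ((firstCycle n (2 * m + 1) ^ t) b : ℕ) else 0) +
          (if ((firstCycle n (2 * m + 1) ^ t) b : ℕ) = 2 * m then
            deltaSign m ((firstCycle n (2 * m + 1) ^ t) a : ℕ) else 0) = 0 := by
        intro a b ha t
        rw [firstCycle_pow_of_le t ha, if_neg (by omega)]
        have : deltaSign m a = 0 := by
          simp only [deltaSign]
          split_ifs <;> omega
        simp [this]
      rcases Nat.lt_or_ge a (2 * m + 1) with ha | ha
      · rcases Nat.lt_or_ge b (2 * m + 1) with hb | hb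
        · simp only [val_firstCycle_pow_of_lt hm _ ha, val_firstCycle_pow_of_lt hm _ hb]
          rw [sum_deltaSign ha, sum_deltaSign hb, deltaSign_add_deltaSign ha hb]
        · rw [← Finset.sum_add_distrib]
          refine Finset.sum_eq_zero fun t _ => ?_
          rw [add_comm]
          exact hfix b a hb t
      · rw [← Finset.sum_add_distrib]
        exact Finset.sum_eq_zero fun t _ => hfix a b ha t

theorem orderOf_deltaElt {n p : ℕ} (hp : p.Prime) (hodd : Odd p) (hpn : p ≤ n) :
    orderOf (deltaElt n p) = p := by
  obtain ⟨m, rfl⟩ := hodd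
  have : Fact (2 * m + 1).Prime := ⟨hp⟩
  have hm : 0 < m := Nat.pos_of_ne_zero fun h => by subst h; exact hp.one_lt.ne rfl
  refine orderOf_eq_prime (deltaElt_pow_self hpn) fun h => ?_
  have h1 := strandPerm_deltaElt hpn
  rw [h, strandPerm_one] at h1
  have h2 := val_firstCycle_pow_of_lt hpn 1 (a := ⟨0, by omega⟩) (by simp)
  rw [pow_one, ← h1, Nat.mod_eq_of_lt (by simp; omega)] at h2
  simp at h2

/-! ### Lifts of permutations and the linear system. -/

theorem isConj_firstCycle_pow {n p k : ℕ} (hp : p.Prime) (hpn : p ≤ n) (h : k.Coprime p) :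
    IsConj (firstCycle n p) (firstCycle n p ^ k) := by
  have hlen : ((List.finRange n).take p).length = p := by simp [hpn]
  have hcyc : (firstCycle n p).IsCycle := List.isCycle_formPerm
    ((List.nodup_finRange n).sublist (List.take_sublist p _)) (by rw [hlen]; exact hp.two_le)
  have hord : k.Coprime (orderOf (firstCycle n p)) :=
    h.coprime_dvd_right (orderOf_dvd_of_pow_eq_one (firstCycle_pow_self hpn))
  exact hcyc.isConj (hcyc.pow_iff.2 hord) (by rw [Equiv.Perm.support_pow_coprime hord])

theorem strandPerm_surjective (n : ℕ) :
    Function.Surjective (strandPerm : BraidQuotient n → Equiv.Perm (Fin n)) := by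
  intro g
  cases n with
  | zero => exact ⟨1, Subsingleton.elim _ _⟩
  | succ n =>
    have hg : g ∈ Submonoid.closure (Set.range fun i : Fin n ↦ Equiv.swap i.castSucc i.succ) := by
      rw [Equiv.Perm.mclosure_swap_castSucc_succ]; exact Submonoid.mem_top g
    induction hg using Submonoid.closure_induction with
    | mem x hx =>
      obtain ⟨i, rfl⟩ := hx
      exact ⟨quotGen (n + 1) i, strandPerm_quotGen (by omega)⟩
    | one => exact ⟨1, strandPerm_one⟩
    | mul x y _ _ hx hy =>
      obtain ⟨a, rfl⟩ := hx
      obtain ⟨b, rfl⟩ := hy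
      exact ⟨b * a, strandPerm_mul b a⟩

/-- The total number of crossings, as a homomorphism. -/
def totalCrossing (n : ℕ) : BraidQuotient n →* Multiplicative ℤ where
  toFun g := Multiplicative.ofAdd (∑ e, crossNum g e)
  map_one' := by simp
  map_mul' g h := by
    rw [← ofAdd_add]
    congr 1
    simp only [crossNum_mul, Finset.sum_add_distrib]
    congr 1
    exact Equiv.sum_comp (pairPerm (Fin n) (strandPerm g)) (crossNum h)

theorem strandPerm_conj_of_braidQuotientPerm {n : ℕ} {γ δ : BraidQuotient n} {k : ℕ}
    (h : braidQuotientPerm n γ * MulOpposite.op (strandPerm δ) * (braidQuotientPerm n γ)⁻¹ =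
      MulOpposite.op (strandPerm δ) ^ k) : strandPerm (γ * δ * γ⁻¹) = strandPerm (δ ^ k) := by
  have h1 := congrArg MulOpposite.unop h
  simpa [braidQuotientPerm_eq] using h1

/-- Comparing crossing numbers gives exactly twice the linear equation, since each `A_{i,j}` counts
2; diagonal pairs contribute nothing. -/
theorem conj_eq_pow_iff {n k : ℕ} {γ δ : BraidQuotient n} {c : Sym2 (Fin n) → ℤ}
    (hγ : γ * δ * γ⁻¹ = pureProd n c * δ ^ k) (x : Sym2 (Fin n) → ℤ) :
    (pureProd n x * γ) * δ * (pureProd n x * γ)⁻¹ = δ ^ k ↔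
      ∀ i j : Fin n, i < j →
        x s(i, j) + c s(i, j) - x s((strandPerm δ ^ k) i, (strandPerm δ ^ k) j) = 0 := by
  have h1 : (pureProd n x * γ) * δ * (pureProd n x * γ)⁻¹ =
      pureProd n x * (pureProd n c * δ ^ k) * (pureProd n x)⁻¹ := by
    rw [← hγ]; group
  have h2 : ∀ i j : Fin n, crossNum ((pureProd n x * γ) * δ * (pureProd n x * γ)⁻¹) s(i, j) =
      crossNum (δ ^ k) s(i, j) + if i = j then 0 else
        2 * (x s(i, j) + c s(i, j) - x s((strandPerm δ ^ k) i, (strandPerm δ ^ k) j)) := by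
    intro i j
    rw [h1]
    simp only [crossNum_mul, crossNum_inv, crossNum_pureProd, strandPerm_mul, strandPerm_pureProd,
      strandPerm_pow, inv_one, mul_one, Equiv.Perm.coe_one, id_eq, Sym2.map_mk,
      Sym2.mk_isDiag_iff, EmbeddingLike.apply_eq_iff_eq]
    split_ifs <;> ring
  constructor
  · intro h i j hij
    have h3 := h2 i j
    rw [h, if_neg hij.ne] at h3
    linarith
  · intro h
    refine braidQuotient_ext (by rw [h1]; simp) fun e => ?_
    induction e with
    | _ i j =>
      rw [h2]
      rcases lt_trichotomy i j with hij | hij | hij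
      · rw [if_neg hij.ne, h i j hij]; ring
      · rw [if_pos hij, add_zero]
      · rw [if_neg hij.ne', Sym2.eq_swap, Sym2.eq_swap (a := (strandPerm δ ^ k) i), h j i hij]
        ring

/-- The crossing numbers of `(γ * δ * γ⁻¹) ^ p` and `(δ ^ k) ^ p` all vanish, and they differ by
twice the orbit sum of `c`. Diagonal values of `c` are arbitrary and are therefore replaced by 0. -/
theorem sum_orbit_eq_zero {n p k : ℕ} {γ δ : BraidQuotient n} {c : Sym2 (Fin n) → ℤ}
    (hδ : δ ^ p = 1) (hγ : γ * δ * γ⁻¹ = pureProd n c * δ ^ k) (e : Sym2 (Fin n)) :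
    ∑ t ∈ Finset.range p, (fun e : Sym2 (Fin n) => if e.IsDiag then 0 else c e)
      ((pairPerm (Fin n) (strandPerm δ ^ k) ^ t) e) = 0 := by
  have h1 : crossNum ((γ * δ * γ⁻¹) ^ p) e = 0 := by
    rw [conj_pow, hδ, mul_one, mul_inv_cancel, crossNum_one]
  have h2 : crossNum ((δ ^ k) ^ p) e = 0 := by
    rw [← pow_mul, mul_comm, pow_mul, hδ, one_pow, crossNum_one]
  rw [hγ, crossNum_pow] at h1
  rw [crossNum_pow] at h2
  simp only [crossNum_mul, strandPerm_mul, strandPerm_pureProd, mul_one, Equiv.Perm.coe_one,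
    Sym2.map_id, id_eq, Finset.sum_add_distrib, h2, add_zero, crossNum_pureProd] at h1
  simp only [pairPerm_pow_apply, strandPerm_pow] at h1 ⊢
  have h3 : 2 * ∑ t ∈ Finset.range p,
      (if (Sym2.map ((strandPerm δ ^ k) ^ t : Equiv.Perm (Fin n)) e).IsDiag then 0 else
        c (Sym2.map ((strandPerm δ ^ k) ^ t : Equiv.Perm (Fin n)) e)) = 0 := by
    refine Eq.trans ?_ h1
    rw [Finset.mul_sum]
    refine Finset.sum_congr rfl fun t _ => ?_
    rw [mul_ite, mul_zero]
  linarith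

theorem totalCrossing_pureProd_add_one {n : ℕ} (hn : 2 ≤ n) (x : Sym2 (Fin n) → ℤ) :
    totalCrossing n (pureProd n (x + 1)) ≠ totalCrossing n (pureProd n x) := by
  intro h
  have h1 : ∑ e, crossNum (pureProd n (x + 1)) e = ∑ e, crossNum (pureProd n x) e :=
    congrArg Multiplicative.toAdd h
  refine (Finset.sum_lt_sum (fun e _ => ?_) ⟨s(⟨0, by omega⟩, ⟨1, by omega⟩), by simp, ?_⟩).ne' h1
  · rw [crossNum_pureProd, crossNum_pureProd]
    split_ifs <;> simp
  · rw [crossNum_pureProd, crossNum_pureProd, if_neg (by simp), if_neg (by simp)]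
    simp

theorem exists_solution {n p k : ℕ} (hn : 2 ≤ n) (hp : 0 < p) {γ δ : BraidQuotient n}
    {c : Sym2 (Fin n) → ℤ} (hδ : δ ^ p = 1) (hγ : γ * δ * γ⁻¹ = pureProd n c * δ ^ k) :
    ∃ x : Sym2 (Fin n) → ℤ, totalCrossing n (pureProd n x * γ) ≠ 1 ∧
      ∀ i j : Fin n, i < j →
        x s(i, j) + c s(i, j) - x s((strandPerm δ ^ k) i, (strandPerm δ ^ k) j) = 0 := by
  have hT : pairPerm (Fin n) (strandPerm δ ^ k) ^ p = 1 := by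
    rw [← map_pow, ← strandPerm_pow, ← strandPerm_pow, ← pow_mul, mul_comm, pow_mul, hδ, one_pow,
      strandPerm_one, map_one]
  obtain ⟨x, hx⟩ := exists_coboundary _
    (fun e : Sym2 (Fin n) => if e.IsDiag then 0 else c e) hp hT (sum_orbit_eq_zero hδ hγ)
  have hx' : ∀ i j : Fin n, i < j →
      x s(i, j) + c s(i, j) - x s((strandPerm δ ^ k) i, (strandPerm δ ^ k) j) = 0 := by
    intro i j hij
    have h := hx s(i, j)
    rw [pairPerm_apply, Sym2.map_mk, if_neg (by exact hij.ne)] at h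
    rw [h, sub_self]
  -- Constants solve the homogeneous system. If the total crossing number happens to vanish, adding
  -- 1 to all exponents makes it nonzero.
  by_cases h : totalCrossing n (pureProd n x * γ) = 1
  · refine ⟨x + 1, fun h1 => totalCrossing_pureProd_add_one hn x ?_, fun i j hij => ?_⟩
    · rw [map_mul] at h h1
      exact mul_right_cancel (h1.trans h.symm)
    · have := hx' i j hij
      simp only [Pi.add_apply, Pi.one_apply]
      linarith
  · exact ⟨x, h, hx'⟩

theorem theorem3 (n p k : ℕ) (hn : 3 ≤ n) (hp : p.Prime) (hodd : Odd p) (hpn : p ≤ n)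
    (hk : 1 ≤ k) (hkp : k ≤ p - 1) :
    -- the group has the presentation `⟨A, B | A ^ p = 1, B A B⁻¹ = A ^ k⟩`
    (∃ e : PresentedGroup (semidirectRels p k) ≃*
          ZpSemidirectZ p k (coprime_of_pos_of_lt_prime hp hk hkp),
        e (PresentedGroup.of 0) = genA p k (coprime_of_pos_of_lt_prime hp hk hkp) ∧
        e (PresentedGroup.of 1) = genB p k (coprime_of_pos_of_lt_prime hp hk hkp)) ∧
    orderOf (deltaElt n p) = p ∧
    -- there are lifts `γ` of permutations conjugating `(1 … p)` to `(1 … p) ^ k`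
    (∃ γ : BraidQuotient n,
      braidQuotientPerm n γ * MulOpposite.op (firstCycle n p) * (braidQuotientPerm n γ)⁻¹ =
        MulOpposite.op (firstCycle n p) ^ k) ∧
    -- every such lift, corrected by a solution of an integer linear system, serves as `B`
    ∀ γ : BraidQuotient n,
      braidQuotientPerm n γ * MulOpposite.op (firstCycle n p) * (braidQuotientPerm n γ)⁻¹ =
        MulOpposite.op (firstCycle n p) ^ k →
      ∃ c : Sym2 (Fin n) → ℤ,
        γ * deltaElt n p * γ⁻¹ = pureProd n c * deltaElt n p ^ k ∧
        (∀ x : Sym2 (Fin n) → ℤ,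
          (pureProd n x * γ) * deltaElt n p * (pureProd n x * γ)⁻¹ = deltaElt n p ^ k ↔
          ∀ i j : Fin n, i < j →
            x s(i, j) + c s(i, j) -
              x s((firstCycle n p ^ k) i, (firstCycle n p ^ k) j) = 0) ∧
        ∃ x : Sym2 (Fin n) → ℤ,
          (∀ i j : Fin n, i < j →
            x s(i, j) + c s(i, j) -
              x s((firstCycle n p ^ k) i, (firstCycle n p ^ k) j) = 0) ∧
          ∃ φ : ZpSemidirectZ p k (coprime_of_pos_of_lt_prime hp hk hkp) →* BraidQuotient n,
            Function.Injective φ ∧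
            φ (genA p k (coprime_of_pos_of_lt_prime hp hk hkp)) = deltaElt n p ∧
            φ (genB p k (coprime_of_pos_of_lt_prime hp hk hkp)) = pureProd n x * γ := by
  have hcop := coprime_of_pos_of_lt_prime hp hk hkp
  have : NeZero p := ⟨hp.ne_zero⟩
  have hδ : deltaElt n p ^ p = 1 :=
    orderOf_dvd_iff_pow_eq_one.1 (orderOf_deltaElt hp hodd hpn).dvd
  have hperm : strandPerm (deltaElt n p) = firstCycle n p := by
    obtain ⟨m, rfl⟩ := hodd
    exact strandPerm_deltaElt hpn
  refine ⟨exists_presentation_equiv hcop, orderOf_deltaElt hp hodd hpn, ?_, ?_⟩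
  · obtain ⟨g, hg⟩ := isConj_iff.1 (isConj_firstCycle_pow hp hpn hcop)
    -- The inverse appears because left-to-right multiplication reverses the conjugation.
    obtain ⟨γ, hγ⟩ := strandPerm_surjective n g⁻¹
    refine ⟨γ, MulOpposite.unop_injective ?_⟩
    simp [braidQuotientPerm_eq, hγ, ← hg, mul_assoc]
  · intro γ hγ
    rw [← hperm] at hγ ⊢
    have h1 := strandPerm_conj_of_braidQuotientPerm hγ
    obtain ⟨c, hc⟩ := exists_eq_pureProd
      (g := γ * deltaElt n p * γ⁻¹ * (deltaElt n p ^ k)⁻¹) (by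
        rw [strandPerm_mul, h1, strandPerm_inv, inv_mul_cancel])
    rw [mul_inv_eq_iff_eq_mul] at hc
    refine ⟨c, hc, conj_eq_pow_iff hc, ?_⟩
    obtain ⟨x, hx0, hx⟩ := exists_solution (by omega) hp.pos hδ hc
    obtain ⟨φ, hφA, hφB⟩ := exists_semidirect_lift hcop hδ ((conj_eq_pow_iff hc x).2 hx)
    refine ⟨x, hx, φ, semidirect_hom_injective hcop ?_ (totalCrossing n) ?_, hφA, hφB⟩
    · rw [hφA]; exact orderOf_deltaElt hp hodd hpn
    · rw [hφB]; exact hx0
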